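/- Let $(\Omega,\mathcal B,\mathbb Q)$ be a probability space, $Y,Y_1,Y_2,\dots$ i.i.d. real random variables on it, $X_n=x+Y_1+\cdots+Y_n$, and $\beta\in\mathbb R$. Assume: * Condition $(\Phi,\mathrm{sym})$: the characteristic function $\Phi(\xi)=\mathbb E[e^{i\xi Y}]$ admits analytic continuation (also denoted $\Phi$) to a strip $\{\mu_-<\operatorname{Im}\xi<\mu_+\}$ with $\mu_-<0<\mu_+$ and $\beta\in(-\mu_+,-\mu_-)$, and $\Phi(\xi-i\beta)=\Phi(-\xi-i\beta)\ge 0$ for all $\xi\in\mathbb R$; * Condition $(G;\beta)$: $G:\mathbb R\to\mathbb R$ is measurable and $G(x)=e^{\beta x}G_\beta(x)$ with $G_\beta\in L_2(\mathbb R)$. Let $\hat G$ denote the Fourier transform of $G$ on the line $\operatorname{Im}\xi=-\beta$, i.e. $\hat G(\eta-i\beta)$, $\eta\in\mathbb R$, is the $L_2$-Fourier transform of $G_\beta$ (formally $\int_{\mathbb R}e^{-ix\eta}G_\beta(x)\,dx$). For $q_0\in(0,1]$ and an integer $n>2$ let $V_{eu}(G,q_0;n,x)=\mathbb E[q_0^nG(X_n)]$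 be the price of the European option with payoff $G$. For $b>0$ and $\sigma,\omega\in\mathbb R$ let $\mathcal L_{L;\sigma,b,\omega}$ be the curve $y\mapsto\sigma+ib\sinh(i\omega+y)$, $y$ increasing from $-\infty$ to $+\infty$. Then for any $r_0\in(0,1/\Phi(-i\beta))$ and $\omega_\ell\in(-\pi/2,0)$ there exist $\sigma_\ell\in\mathbb R$ and $b_\ell>0$ such that $\sigma_\ell-b_\ell\sin(\omega_\ell)=r_0$, $q\ne0$ and $1-q\Phi(\xi)\neq 0$ for all $q\in\mathcal L_{L;\sigma_\ell,b_\ell,\omega_\ell}$ and all $\xi$ with $\operatorname{Im}\xi=-\beta$, and $$V_{eu}(G,q_0;n,x)=\frac{q_0^n}{2\pi i}\int_{\mathcal L_{L;\sigma_\ell,b_\ell,\omega_\ell}}dq\,q^{-n}\,\frac1{2\pi}\int_{\operatorname{Im}\xi=-\beta}e^{ix\xi}\,\frac{\Phi(\xi)\hat G(\xi)}{1-q\Phi(\xi)}\,d\xi\qquad(*)$$ in the following sense. 1. $V_{eu}(G,q_0;n,x)$ is well defined (that is, $G(X_n)$ is $\mathbb Q$-integrable) for almost every $x$, it is locally integrable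 in $x$, and $(*)$ holds in the sense of generalized functions of $x$: for every $\varphi\in C_c^\infty(\mathbb R;\mathbb C)$, $$\int_{\mathbb R}V_{eu}(G,q_0;n,x)\varphi(x)\,dx=\frac{q_0^n}{2\pi i}\int_{\mathcal L_{L;\sigma_\ell,b_\ell,\omega_\ell}}dq\,q^{-n}\,\frac1{2\pi}\int_{\operatorname{Im}\xi=-\beta}\Big(\int_{\mathbb R}e^{ix\xi}\varphi(x)\,dx\Big)\frac{\Phi(\xi)\hat G(\xi)}{1-q\Phi(\xi)}\,d\xi ,$$ where the integral in $\xi$, for each $q$ on the contour, and the integral in $q$ converge absolutely. 2. If, moreover, $\Phi\hat G\in L_1(-i\beta+\mathbb R)$, then $(*)$ holds in the classical sense: the inner integral (for each $q$ on the contour) and the outer integral converge absolutely for every $x$, and $(*)$ holds for almost every $x$ and at every $x$ at which the function $V_{eu}(G,q_0;n,\cdot)$ is continuous. -/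

import Mathlib

open MeasureTheory ProbabilityTheory
open scoped FourierTransform ContDiff

noncomputable section

/-- `Y 0, Y 1, …` are i.i.d. real random variables on a probability space with measure `Q`. -/
structure IsIID {Ω : Type*} [MeasurableSpace Ω] (Q : Measure Ω) (Y : ℕ → Ω → ℝ) : Prop where
  measurable : ∀ j, Measurable (Y j)
  indep : iIndepFun Y Q
  ident : ∀ j, IdentDistrib (Y j) (Y 0) Q Q

/-- The random walk `X_n = x + (sum of the first n increments)` started at `x`. -/
def randomWalk {Ω : Type*} (Y : ℕ → Ω → ℝ) (x : ℝ) (n : ℕ) (w : Ω) : ℝ :=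
  x + ∑ j ∈ Finset.range n, Y j w

/-- Price of the European option with payoff `G`, maturity `n` and one-period discount
factor `q₀`, when the walk starts at `x`: the expectation of `q₀ ^ n * G (X_n)`. -/
def europeanPrice {Ω : Type*} [MeasurableSpace Ω] (Q : Measure Ω) (Y : ℕ → Ω → ℝ)
    (G : ℝ → ℝ) (q₀ : ℝ) (n : ℕ) (x : ℝ) : ℝ :=
  ∫ w, q₀ ^ n * G (randomWalk Y x n w) ∂Q

/-- The open horizontal strip `{z | m < Im z < M}`. -/
def horizontalStrip (m M : ℝ) : Set ℂ := {z | m < z.im ∧ z.im < M}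

/-- The point `η - i β` of the line `{Im ξ = -β}`. -/
def linePt (β η : ℝ) : ℂ := (η : ℂ) - Complex.I * (β : ℂ)

/-- The symmetry condition: `Φ` is analytic on an open strip that contains the real line and
the line `{Im ξ = -β}`, it agrees on the real line with the characteristic function of the
law `ν`, and on the line `{Im ξ = -β}` it is even about `-iβ`, real and non-negative. -/
structure CondPhiSym (ν : Measure ℝ) (Φ : ℂ → ℂ) (β : ℝ) : Prop where
  continuation : ∃ m M : ℝ, m < 0 ∧ 0 < M ∧ -M < β ∧ β < -m ∧
    DifferentiableOn ℂ Φ (horizontalStrip m M) ∧ ∀ t : ℝ, Φ (t : ℂ) = charFun ν t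
  symm : ∀ η : ℝ, Φ (linePt β η) = Φ (linePt β (-η))
  im_eq_zero : ∀ η : ℝ, (Φ (linePt β η)).im = 0
  re_nonneg : ∀ η : ℝ, 0 ≤ (Φ (linePt β η)).re

/-- The function `G_β(x) = e^{-β x} G(x)`. -/
def dampedPayoff (G : ℝ → ℝ) (β : ℝ) (x : ℝ) : ℂ :=
  ((Real.exp (-(β * x)) * G x : ℝ) : ℂ)

/-- The condition on the payoff: `G` is measurable and `G(x) = e^{β x} G_β(x)`
with `G_β` in `L²(ℝ)`. -/
structure CondG (G : ℝ → ℝ) (β : ℝ) : Prop where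
  measurable : Measurable G
  memLp : MemLp (dampedPayoff G β) 2 volume

/-- The Fourier transform of `G` on the line `{Im ξ = -β}`, as a function of `η` where
`ξ = η - i β`. Formally it is `∫ e^{-i x ξ} G(x) dx = ∫ e^{-i x η} G_β(x) dx`, so it is the
`L²` (Plancherel) transform of `G_β`; Mathlib's transform has the kernel `e^{-2 π i x t}`,
hence the argument `η / (2 π)`. -/
def payoffFourier {G : ℝ → ℝ} {β : ℝ} (hG : CondG G β) (η : ℝ) : ℂ :=
  (𝓕 (hG.memLp.toLp (dampedPayoff G β)) : Lp ℂ 2 (volume : Measure ℝ)) (η / (2 * Real.pi))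

/-- The conformal map `y ↦ σ + i b sinh (i θ + y)`; its image of the real line, run through in
the direction of increasing `y`, is the sinh-contour with parameters `σ, b, θ`. -/
def sinhContour (σ b θ : ℝ) (y : ℝ) : ℂ :=
  (σ : ℂ) + Complex.I * (b : ℂ) * Complex.sinh (Complex.I * (θ : ℂ) + (y : ℂ))

/-- The integrand of the contour integral `∫ f(q) dq` along `y ↦ γ y`. -/
def pathIntegrand (γ : ℝ → ℂ) (f : ℂ → ℂ) (y : ℝ) : ℂ := f (γ y) * deriv γ y

/-- The contour integral `∫ f(q) dq` along the infinite path `y ↦ γ y`, `y ∈ ℝ`. -/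
def pathIntegral (γ : ℝ → ℂ) (f : ℂ → ℂ) : ℂ := ∫ y : ℝ, pathIntegrand γ f y

/-- `Φ(ξ) Ĝ(ξ) / (1 - q Φ(ξ))` at `ξ = η - i β`. -/
def symbolQuotient {G : ℝ → ℝ} {β : ℝ} (Φ : ℂ → ℂ) (hG : CondG G β) (q : ℂ) (η : ℝ) : ℂ :=
  Φ (linePt β η) * payoffFourier hG η / (1 - q * Φ (linePt β η))

/-- The integrand `e^{i x ξ} Φ(ξ) Ĝ(ξ) / (1 - q Φ(ξ))` of the inner integral, `ξ = η - i β`. -/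
def innerIntegrand {G : ℝ → ℝ} {β : ℝ} (Φ : ℂ → ℂ) (hG : CondG G β) (x : ℝ) (q : ℂ)
    (η : ℝ) : ℂ :=
  Complex.exp (Complex.I * (x : ℂ) * linePt β η) * symbolQuotient Φ hG q η

/-- The inner integral, `1 / (2 π)` times the integral over the line `{Im ξ = -β}`,
at the point `x`. -/
def innerIntegral {G : ℝ → ℝ} {β : ℝ} (Φ : ℂ → ℂ) (hG : CondG G β) (x : ℝ) (q : ℂ) : ℂ :=
  1 / (2 * (Real.pi : ℂ)) * ∫ η : ℝ, innerIntegrand Φ hG x q η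

/-- `∫ e^{i x ξ} φ(x) dx`, for a test function `φ` and complex `ξ`. -/
def testTransform (φ : ℝ → ℂ) (ξ : ℂ) : ℂ :=
  ∫ x : ℝ, Complex.exp (Complex.I * (x : ℂ) * ξ) * φ x

/-- The integrand in `η` of the pairing of the inner integral, as a generalized function
of `x`, with the test function `φ`. -/
def innerPairingIntegrand {G : ℝ → ℝ} {β : ℝ} (Φ : ℂ → ℂ) (hG : CondG G β) (φ : ℝ → ℂ) (q : ℂ)
    (η : ℝ) : ℂ :=
  testTransform φ (linePt β η) * symbolQuotient Φ hG q η

/-- The inner Fourier integral as a generalized function of `x`, evaluated at the test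
function `φ` (the exponential `e^{i x ξ}` is paired with `φ` before the integration in `ξ`). -/
def innerPairing {G : ℝ → ℝ} {β : ℝ} (Φ : ℂ → ℂ) (hG : CondG G β) (φ : ℝ → ℂ) (q : ℂ) : ℂ :=
  1 / (2 * (Real.pi : ℂ)) * ∫ η : ℝ, innerPairingIntegrand Φ hG φ q η

end

open MeasureTheory ProbabilityTheory
open scoped FourierTransform ContDiff

noncomputable section

/-! On the line `Im ξ = -β` the symbol is a real function `f` with `0 ≤ f ≤ f 0`, and `r₀ * f 0 <
1`. With `σ = 0` the sinh-contour is a branch of a hyperbola with vertex `r₀`, which separates `0`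
from every pole `1 / f η`. Cauchy's formula for the coefficients of `f / (1 - q f)` therefore gives
`f ^ n` for each `η` (`integral_resolvent_hyperbola`, proved with explicit primitives and the jump
of a logarithm). The distance from `q f` to `1` is bounded below uniformly in `q` and `η`, so Fubini
carries this under the `η`-integral (`contour_integral_eq`).

It remains to represent the price by `f ^ n`. Tilting the law of the sum of increments by `exp (β
s)` turns the price into `q₀ ^ n * exp (β x)` times the integral of the translates of `G_β` against
a finite measure whose characteristic function is `f ^ n`. Plancherel's identity for such an
integral (`integral_mul_integral_translate`) gives the formula against test functions. If `Φ Ĝ` is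
integrable, the right side is a continuous function of `x`, and equality as distributions becomes
equality almost everywhere (`ae_exp_mul_translate_eq`), hence at points of continuity.

The tilted measure is finite only if `E exp (β Y)` is, while the hypothesis speaks of analyticity of
`Φ`. This gap is closed by `mem_interior_integrableExpSet_of_charFun_eq`: Taylor coefficients
control the even moments, hence the exponential moments inside a disc about `0`, and repeated
tilting moves the centre of the disc to `β`. -/

/-! ### Exponential moments from an analytic characteristic function -/

open Filter Topology in
/-- A finite measure has a finite second moment if its characteristic function has bounded second
difference quotients at the origin. -/
theorem integrable_sq_of_charFun_diff_bound {μ : Measure ℝ} [IsFiniteMeasure μ] {C R : ℝ}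
    (hR : 0 < R)
    (h : ∀ t : ℝ, |t| < R → (2 * charFun μ 0 - charFun μ t - charFun μ (-t)).re ≤ C * t ^ 2) :
    Integrable (fun x : ℝ => x ^ 2) μ := by
  have hint : ∀ t : ℝ, Integrable (fun x : ℝ => Real.cos (t * x)) μ := fun t =>
    Integrable.of_bound (C := 1) (by fun_prop) (ae_of_all _ fun x => by
      simpa using Real.abs_cos_le_one _)
  have hre : ∀ t : ℝ, (charFun μ t).re = ∫ x, Real.cos (t * x) ∂μ := by
    intro t
    rw [charFun_apply_real, ← RCLike.re_eq_complex_re, ← integral_re]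
    · refine integral_congr_ae (ae_of_all _ fun x => ?_)
      simp only [RCLike.re_eq_complex_re]
      rw [← Complex.ofReal_mul, Complex.exp_ofReal_mul_I_re]
    · exact Integrable.of_bound (C := 1) (by fun_prop) (ae_of_all _ fun x => by
        rw [← Complex.ofReal_mul, Complex.norm_exp_ofReal_mul_I])
  have hval : ∀ t : ℝ, ∫ x, (2 - 2 * Real.cos (t * x)) ∂μ =
      (2 * charFun μ 0 - charFun μ t - charFun μ (-t)).re := by
    intro t
    rw [integral_sub (integrable_const _) ((hint t).const_mul _), integral_const_mul]
    simp only [Complex.sub_re, Complex.mul_re, hre]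
    simp
    ring
  -- The shift by `2` keeps `u 0` strictly below `R`.
  let u : ℕ → ℝ := fun k => R / (k + 2)
  have hupos : ∀ k, 0 < u k := fun k => by positivity
  have huR : ∀ k, |u k| < R := fun k => by
    rw [abs_of_pos (hupos k), div_lt_iff₀ (by positivity)]
    nlinarith [(Nat.cast_nonneg k : (0 : ℝ) ≤ k)]
  have hu : Tendsto u atTop (𝓝[≠] 0) := by
    refine tendsto_nhdsWithin_iff.2 ⟨?_, Eventually.of_forall fun k => (hupos k).ne'⟩
    have := (tendsto_const_div_atTop_nhds_zero_nat R).comp (tendsto_add_atTop_nat 2)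
    refine this.congr fun k => ?_
    simp [u]
  -- Fatou: the quotients `(2 - 2 cos (u x)) / u ^ 2` are nonnegative, tend to `x ^ 2`, and have
  -- integrals at most `C`.
  refine integrable_of_tendsto
    (G := fun k x => (2 - 2 * Real.cos (u k * x)) / u k ^ 2) (ae_of_all _ fun x => ?_)
    (fun k => by fun_prop) ?_
  · have key : Tendsto (fun t : ℝ => (2 - 2 * Real.cos (t * x)) / t ^ 2) (𝓝[≠] 0) (𝓝 (x ^ 2)) := by
      have h1 : HasDerivAt (fun t : ℝ => Real.sin (t * (x / 2))) (x / 2) 0 := by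
        simpa using ((hasDerivAt_id (0 : ℝ)).mul_const (x / 2)).sin
      have h2 := (hasDerivAt_iff_tendsto_slope.1 h1)
      have h3 := (h2.pow 2).const_mul 4
      have e : 4 * (x / 2) ^ 2 = x ^ 2 := by ring
      rw [e] at h3
      refine h3.congr' ?_
      filter_upwards [self_mem_nhdsWithin] with t ht
      have ht' : t ≠ 0 := ht
      simp only [slope_def_field, zero_mul, Real.sin_zero, sub_zero]
      have : Real.cos (t * x) = 1 - 2 * Real.sin (t * (x / 2)) ^ 2 := by
        rw [show t * x = 2 * (t * (x / 2)) by ring, Real.cos_two_mul, Real.cos_sq']; ring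
      rw [this]; field_simp; ring
    exact key.comp hu
  · have hb : ∀ k, ∫⁻ x, ‖(2 - 2 * Real.cos (u k * x)) / u k ^ 2‖ₑ ∂μ ≤ ENNReal.ofReal C := by
      intro k
      have hnn : ∀ x, 0 ≤ (2 - 2 * Real.cos (u k * x)) / u k ^ 2 := fun x =>
        div_nonneg (by linarith [Real.cos_le_one (u k * x)]) (sq_nonneg _)
      have hi : Integrable (fun x => (2 - 2 * Real.cos (u k * x)) / u k ^ 2) μ :=
        ((integrable_const _).sub ((hint _).const_mul _)).div_const _
      simp_rw [fun x => Real.enorm_of_nonneg (hnn x)]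
      rw [← ofReal_integral_eq_lintegral_ofReal hi (ae_of_all _ hnn)]
      refine ENNReal.ofReal_le_ofReal ?_
      rw [integral_div, hval, div_le_iff₀ (pow_pos (hupos k) 2)]
      exact h _ (huR k)
    refine ne_top_of_le_ne_top (ENNReal.ofReal_ne_top (r := C))
      ((liminf_le_liminf (Eventually.of_forall hb)).trans ?_)
    simp

theorem charFun_withDensity_sq {μ : Measure ℝ} (t : ℝ) :
    charFun (μ.withDensity fun x => ENNReal.ofReal (x ^ 2)) t =
      ∫ x : ℝ, (x : ℂ) ^ 2 * Complex.exp (t * x * Complex.I) ∂μ := by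
  rw [charFun_apply_real, integral_withDensity_eq_integral_toReal_smul (by fun_prop)
    (ae_of_all _ fun _ => ENNReal.ofReal_lt_top)]
  refine integral_congr_ae (ae_of_all _ fun x => ?_)
  simp [ENNReal.toReal_ofReal (sq_nonneg x)]

open Filter Topology in
theorem deriv_eq_of_eq_ofReal {F : ℂ → ℂ} {g : ℝ → ℂ} {R : ℝ}
    (hF : DifferentiableOn ℂ F (Metric.ball 0 R))
    (h : ∀ t : ℝ, |t| < R → g t = F t) : ∀ t : ℝ, |t| < R → deriv g t = deriv F t := by
  intro t ht
  have ht' : (t : ℂ) ∈ Metric.ball (0 : ℂ) R := by simpa using ht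
  have hd := ((hF.differentiableAt (Metric.isOpen_ball.mem_nhds ht')).hasDerivAt).comp_ofReal
  refine (hd.congr_of_eventuallyEq ?_).deriv
  filter_upwards [(isOpen_lt continuous_abs continuous_const).mem_nhds ht] with s hs using h s hs

/-- If the characteristic function of a finite measure is the restriction of a holomorphic function,
then the second moment is finite and minus the second derivative is the characteristic function of
the measure with density `x ^ 2`. -/
theorem integrable_sq_of_charFun_eq {μ : Measure ℝ} [IsFiniteMeasure μ] {F : ℂ → ℂ} {R : ℝ}
    (hR : 0 < R) (hF : DifferentiableOn ℂ F (Metric.ball 0 R))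
    (h : ∀ t : ℝ, |t| < R → charFun μ t = F t) :
    Integrable (fun x : ℝ => x ^ 2) μ ∧ ∀ t : ℝ, |t| < R →
      charFun (μ.withDensity fun x => ENNReal.ofReal (x ^ 2)) t = - deriv (deriv F) t := by
  have hsq : Integrable (fun x : ℝ => x ^ 2) μ := by
    have hn0 : Metric.ball (0 : ℂ) R ∈ nhds 0 := Metric.ball_mem_nhds _ hR
    have h1 : DifferentiableOn ℂ (dslope F 0) (Metric.ball 0 R) :=
      (Complex.differentiableOn_dslope hn0).2 hF
    have h2 : DifferentiableOn ℂ (dslope (dslope F 0) 0) (Metric.ball 0 R) :=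
      (Complex.differentiableOn_dslope hn0).2 h1
    set F2 := dslope (dslope F 0) 0 with hF2
    -- Second-order Taylor expansion with holomorphic remainder. The linear term cancels in the
    -- symmetric second difference, and `F2` is bounded on the half-radius disc.
    have e : ∀ z : ℂ, F z = F 0 + z * (dslope F 0 0 + z * F2 z) := by
      intro z
      have a1 := sub_smul_dslope F 0 z
      have a2 := sub_smul_dslope (dslope F 0) 0 z
      simp only [sub_zero, smul_eq_mul] at a1 a2
      rw [hF2, a2, add_sub_cancel, a1]; ring
    have hsub : Metric.closedBall (0 : ℂ) (R / 2) ⊆ Metric.ball 0 R :=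
      Metric.closedBall_subset_ball (by linarith)
    obtain ⟨C, hC⟩ := (isCompact_closedBall (0 : ℂ) (R / 2)).exists_bound_of_continuousOn
      (h2.continuousOn.mono hsub)
    refine integrable_sq_of_charFun_diff_bound (C := 2 * C) (R := R / 2) (by linarith) ?_
    intro t ht
    have htR : |t| < R := by linarith
    rw [h t htR, h (-t) (by simpa using htR), h 0 (by simpa using hR)]
    have e1 := e t
    have e2 := e (-(t : ℝ) : ℝ)
    refine (Complex.re_le_norm _).trans ?_
    have : 2 * F (0 : ℝ) - F t - F (-t : ℝ) = -((t : ℂ) ^ 2 * (F2 t + F2 (-t : ℝ))) := by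
      rw [e1, e2]; push_cast; ring
    rw [this, norm_neg, norm_mul, norm_pow, Complex.norm_real, Real.norm_eq_abs, sq_abs]
    have b1 := hC t (by simpa using ht.le)
    have b2 := hC (-t : ℝ) (by simpa using ht.le)
    have b3 := norm_add_le (F2 t) (F2 (-t : ℝ))
    nlinarith [sq_nonneg t]
  refine ⟨hsq, fun t ht => ?_⟩
  have hm : MemLp id (2 : ℕ) μ := by
    simpa using (memLp_two_iff_integrable_sq (f := (id : ℝ → ℝ)) (by fun_prop)).2 hsq
  have hi := iteratedDeriv_charFun (t := t) hm
  have hd1 := deriv_eq_of_eq_ofReal hF h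
  have hd2 := deriv_eq_of_eq_ofReal (hF.deriv Metric.isOpen_ball) hd1 t ht
  rw [iteratedDeriv_succ, iteratedDeriv_one, hd2] at hi
  rw [charFun_withDensity_sq, hi]
  simp

/-- The hypotheses are stable under replacing `μ` by `x ^ 2 μ` and `F` by `-F''`, on the same disc.
Induction on `k` runs through this replacement, so `μ` and `F` must vary. -/
theorem even_moment_eq_iteratedDeriv (k : ℕ) : ∀ {μ : Measure ℝ} [IsFiniteMeasure μ] {F : ℂ → ℂ}
    {R : ℝ}, 0 < R → DifferentiableOn ℂ F (Metric.ball 0 R) →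
    (∀ t : ℝ, |t| < R → charFun μ t = F t) →
    Integrable (fun x : ℝ => x ^ (2 * k)) μ ∧
      ((∫ x : ℝ, x ^ (2 * k) ∂μ : ℝ) : ℂ) = (-1) ^ k * iteratedDeriv (2 * k) F 0 := by
  induction k with
  | zero =>
    intro μ _ F R hR hF h
    refine ⟨by simp, ?_⟩
    have := h 0 (by simpa using hR)
    simp at this
    simp [this]
  | succ k ih =>
    intro μ _ F R hR hF h
    obtain ⟨hsq, hchar⟩ := integrable_sq_of_charFun_eq hR hF h
    have hfin : IsFiniteMeasure (μ.withDensity fun x => ENNReal.ofReal (x ^ 2)) :=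
      isFiniteMeasure_withDensity_ofReal hsq.2
    obtain ⟨hi, he⟩ := ih (F := fun z => - deriv (deriv F) z) hR
      (((hF.deriv Metric.isOpen_ball).deriv Metric.isOpen_ball).neg) hchar
    have hd : ∀ x : ℝ, (ENNReal.ofReal (x ^ 2)).toReal • x ^ (2 * k) = x ^ (2 * (k + 1)) := by
      intro x
      rw [ENNReal.toReal_ofReal (sq_nonneg x), smul_eq_mul]; ring
    rw [integrable_withDensity_iff_integrable_smul' (by fun_prop)
      (ae_of_all _ fun _ => ENNReal.ofReal_lt_top)] at hi
    rw [integral_withDensity_eq_integral_toReal_smul (by fun_prop)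
      (ae_of_all _ fun _ => ENNReal.ofReal_lt_top)] at he
    simp_rw [hd] at hi he
    refine ⟨hi, he.trans ?_⟩
    have : (fun z => - deriv (deriv F) z) = - deriv (deriv F) := rfl
    rw [this, iteratedDeriv_neg, show 2 * (k + 1) = 2 * k + 1 + 1 by ring, iteratedDeriv_succ',
      iteratedDeriv_succ']
    ring

/-- If the characteristic function of a finite measure extends holomorphically to a disc of radius
`R` about the origin, then the exponential moments of every order less than `R` are finite. -/
theorem integrable_exp_mul_of_charFun_eq {μ : Measure ℝ} [IsFiniteMeasure μ] {F : ℂ → ℂ}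
    {R r : ℝ}
    (hF : DifferentiableOn ℂ F (Metric.ball 0 R))
    (h : ∀ t : ℝ, |t| < R → charFun μ t = F t) (hr0 : 0 ≤ r) (hr : r < R) :
    Integrable (fun x : ℝ => Real.exp (r * x)) μ ∧
      Integrable (fun x : ℝ => Real.exp (-r * x)) μ := by
  have hR : 0 < R := hr0.trans_lt hr
  have hmom := fun k => even_moment_eq_iteratedDeriv k hR hF h
  -- At `z = i r` the powers of `i` cancel the signs `(-1) ^ k`, so the even Taylor terms are
  -- exactly the nonnegative numbers `E (r x) ^ (2 k) / (2 k)!`.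
  have hT := (Complex.hasSum_taylorSeries_on_ball hF (z := Complex.I * r)
    (by simpa [abs_of_nonneg hr0] using hr)).summable.comp_injective
    (i := fun k : ℕ => 2 * k) (fun a b hab => by simpa using hab)
  have hterm : ∀ k : ℕ, ∀ x : ℝ, ‖(r * x) ^ (2 * k) / ((2 * k).factorial : ℝ)‖ =
      (r * x) ^ (2 * k) / ((2 * k).factorial : ℝ) := fun k x => by
    rw [Real.norm_of_nonneg]
    exact div_nonneg ((even_two_mul k).pow_nonneg _) (by positivity)
  have hint : ∀ k : ℕ, Integrable (fun x : ℝ => (r * x) ^ (2 * k) / ((2 * k).factorial : ℝ)) μ := by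
    intro k
    simp_rw [mul_pow]
    exact ((hmom k).1.const_mul _).div_const _
  have hsum : Summable fun k : ℕ =>
      ∫ x : ℝ, ‖(r * x) ^ (2 * k) / ((2 * k).factorial : ℝ)‖ ∂μ := by
    rw [← Complex.summable_ofReal]
    refine hT.congr fun k => ?_
    simp_rw [hterm, mul_pow]
    rw [integral_div, integral_const_mul]
    have := (hmom k).2
    push_cast at this ⊢
    rw [this]
    simp only [Function.comp, sub_zero, smul_eq_mul, mul_pow]
    rw [pow_mul Complex.I, Complex.I_sq]
    field_simp
  -- Fatou along the partial sums of the `cosh` series; `exp (± r x) ≤ 2 cosh (r x)` then finishes.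
  have hcosh : Integrable (fun x : ℝ => Real.cosh (r * x)) μ := by
    refine integrable_of_tendsto
      (G := fun N x => ∑ k ∈ Finset.range N, (r * x) ^ (2 * k) / ((2 * k).factorial : ℝ))
      (ae_of_all _ fun x => (Real.hasSum_cosh (r * x)).tendsto_sum_nat)
      (fun N => by fun_prop) ?_
    have hb : ∀ N, ∫⁻ x, ‖∑ k ∈ Finset.range N, (r * x) ^ (2 * k) / ((2 * k).factorial : ℝ)‖ₑ ∂μ ≤
        ENNReal.ofReal (∑' k : ℕ, ∫ x : ℝ, ‖(r * x) ^ (2 * k) / ((2 * k).factorial : ℝ)‖ ∂μ) := by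
      intro N
      rw [← ofReal_integral_norm_eq_lintegral_enorm (integrable_finsetSum _ fun k _ => hint k)]
      refine ENNReal.ofReal_le_ofReal ?_
      refine le_trans ?_ (hsum.sum_le_tsum (Finset.range N)
        fun k _ => integral_nonneg fun x => norm_nonneg _)
      rw [← integral_finsetSum _ fun k _ => (hint k).norm]
      exact integral_mono (integrable_finsetSum _ fun k _ => hint k).norm
        (integrable_finsetSum _ fun k _ => (hint k).norm) fun x => norm_sum_le _ _
    refine ne_top_of_le_ne_top ENNReal.ofReal_ne_top
      ((Filter.liminf_le_liminf (Filter.Eventually.of_forall hb)).trans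
        (Filter.liminf_const _).le)
  have hexp : ∀ s : ℝ, |s| = r → Integrable (fun x : ℝ => Real.exp (s * x)) μ := by
    intro s hs
    refine (hcosh.const_mul 2).mono' (by fun_prop) (ae_of_all _ fun x => ?_)
    rw [Real.norm_of_nonneg (Real.exp_pos _).le]
    have e : Real.cosh (r * x) = Real.cosh (s * x) := by
      rw [← hs, ← Real.cosh_abs, ← Real.cosh_abs (s * x), abs_mul, abs_mul, abs_abs]
    rw [e, Real.cosh_eq]
    linarith [Real.exp_pos (-(s * x))]
  exact ⟨hexp r (abs_of_nonneg hr0), hexp (-r) (by rw [abs_neg, abs_of_nonneg hr0])⟩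

-- Identity theorem on a vertical strip, which is convex and hence connected: the two analytic
-- functions agree at the points `i / (k + 1)`, which accumulate at `0`.
open Filter Topology in
theorem complexMGF_eq_of_charFun_eq {ν : Measure ℝ} {Φ : ℂ → ℂ} {m M : ℝ}
    (hm : m < 0) (hM : 0 < M) (hd : DifferentiableOn ℂ Φ (horizontalStrip m M))
    (h : ∀ t : ℝ, Φ t = charFun ν t) (h0 : 0 ∈ interior (integrableExpSet id ν)) {z : ℂ}
    (hz : z.re ∈ interior (integrableExpSet id ν)) (hz' : z.re ∈ Set.Ioo (-M) (-m)) :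
    complexMGF id ν z = Φ (-Complex.I * z) := by
  set J : Set ℝ := interior (integrableExpSet id ν) ∩ Set.Ioo (-M) (-m) with hJ
  set U : Set ℂ := Complex.reLm ⁻¹' J with hU
  have hJo : IsOpen J := isOpen_interior.inter isOpen_Ioo
  have hUo : IsOpen U := hJo.preimage Complex.continuous_re
  have hUc : IsPreconnected U :=
    (((convex_integrableExpSet.interior).inter (convex_Ioo _ _)).linear_preimage _).isPreconnected
  have h1 : AnalyticOnNhd ℂ (complexMGF id ν) U :=
    analyticOnNhd_complexMGF.mono fun z hz => hz.1
  have hmap : ∀ z ∈ U, -Complex.I * z ∈ horizontalStrip m M := by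
    intro z hz
    have := hz.2
    simp only [Complex.reLm_coe, Set.mem_Ioo] at this
    simp only [horizontalStrip, Set.mem_ofPred_eq]
    have e : (-Complex.I * z).im = - z.re := by simp
    rw [e]; constructor <;> linarith
  have h2 : AnalyticOnNhd ℂ (fun z => Φ (-Complex.I * z)) U :=
    (hd.comp (by fun_prop) hmap).analyticOnNhd hUo
  have h00 : (0 : ℂ) ∈ U := ⟨by simpa using h0, by simp [hm, hM]⟩
  refine h1.eqOn_of_preconnected_of_frequently_eq h2 hUc h00 ?_ ⟨hz, hz'⟩
  have ht : Tendsto (fun k : ℕ => ((1 / ((k : ℝ) + 1) : ℝ) : ℂ) * Complex.I) atTop (𝓝[≠] 0) := by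
    refine tendsto_nhdsWithin_iff.2 ⟨?_, Eventually.of_forall fun k => ?_⟩
    · have := ((Complex.continuous_ofReal.tendsto _).comp
        (tendsto_one_div_add_atTop_nhds_zero_nat (𝕜 := ℝ))).mul_const Complex.I
      simpa using this
    · have : (0 : ℝ) < 1 / ((k : ℝ) + 1) := by positivity
      simp only [Set.mem_compl_iff, Set.mem_singleton_iff, mul_eq_zero, Complex.ofReal_eq_zero,
        Complex.I_ne_zero, or_false]
      exact this.ne'
  refine ht.frequently (Eventually.of_forall fun k => ?_).frequently
  rw [complexMGF_id_mul_I, ← h]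
  congr 1
  linear_combination ((1 / ((k : ℝ) + 1) : ℝ) : ℂ) * Complex.I_sq

theorem charFun_withDensity_exp {ν : Measure ℝ} (s t : ℝ) :
    charFun (ν.withDensity fun x => ENNReal.ofReal (Real.exp (s * x))) t =
      complexMGF id ν (s + t * Complex.I) := by
  rw [charFun_apply_real, complexMGF, integral_withDensity_eq_integral_toReal_smul (by fun_prop)
    (ae_of_all _ fun _ => ENNReal.ofReal_lt_top)]
  refine integral_congr_ae (ae_of_all _ fun x => ?_)
  simp only [ENNReal.toReal_ofReal (Real.exp_pos _).le, id, Complex.real_smul]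
  rw [Complex.ofReal_exp, ← Complex.exp_add]
  congr 1; push_cast; ring

/-- If the characteristic function of `ν`, tilted by `exp (s x)`, extends to a disc of radius `δ`,
then the exponential moments of `ν` of orders in `(s - δ, s + δ)` are finite. -/
theorem Ioo_subset_integrableExpSet {ν : Measure ℝ} {F : ℂ → ℂ} {s δ : ℝ}
    (hs : s ∈ integrableExpSet id ν) (hF : DifferentiableOn ℂ F (Metric.ball 0 δ))
    (h : ∀ t : ℝ, |t| < δ → complexMGF id ν (s + t * Complex.I) = F t) :
    Set.Ioo (s - δ) (s + δ) ⊆ interior (integrableExpSet id ν) := by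
  refine interior_maximal (fun u hu => ?_) isOpen_Ioo
  have hs' : Integrable (fun x => Real.exp (s * x)) ν := hs
  have hfin : IsFiniteMeasure (ν.withDensity fun x => ENNReal.ofReal (Real.exp (s * x))) :=
    isFiniteMeasure_withDensity_ofReal hs'.2
  have hr : |u - s| < δ := by rw [abs_lt]; constructor <;> linarith [hu.1, hu.2]
  obtain ⟨i1, i2⟩ := integrable_exp_mul_of_charFun_eq hF
    (fun t ht => (charFun_withDensity_exp s t).trans (h t ht)) (abs_nonneg _) hr
  have key : ∀ r : ℝ, Integrable (fun x : ℝ => Real.exp (r * x))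
      (ν.withDensity fun x => ENNReal.ofReal (Real.exp (s * x))) →
      Integrable (fun x : ℝ => Real.exp ((s + r) * x)) ν := by
    intro r hi
    rw [integrable_withDensity_iff_integrable_smul' (by fun_prop)
      (ae_of_all _ fun _ => ENNReal.ofReal_lt_top)] at hi
    refine hi.congr (ae_of_all _ fun x => ?_)
    simp only [ENNReal.toReal_ofReal (Real.exp_pos _).le, smul_eq_mul]
    rw [← Real.exp_add]; ring_nf
  change Integrable (fun x => Real.exp (u * x)) ν
  rcases abs_choice (u - s) with e | e
  · have := key _ i1
    rwa [e, add_sub_cancel] at this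
  · have := key _ i2
    rwa [e, neg_neg, add_sub_cancel] at this

/-- A characteristic function that extends holomorphically to a horizontal strip comes from a
measure with all the corresponding exponential moments. -/
theorem mem_interior_integrableExpSet_of_charFun_eq {ν : Measure ℝ} [IsFiniteMeasure ν] {Φ : ℂ → ℂ}
    {m M β : ℝ} (hm : m < 0) (hM : 0 < M) (hd : DifferentiableOn ℂ Φ (horizontalStrip m M))
    (h : ∀ t : ℝ, Φ t = charFun ν t) (hβ : -M < β) (hβ' : β < -m) :
    0 ∈ interior (integrableExpSet id ν) ∧ β ∈ interior (integrableExpSet id ν) := by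
  have hball : ∀ s δ : ℝ, δ ≤ s + M → δ ≤ -m - s →
      DifferentiableOn ℂ (fun z => Φ (-Complex.I * (s + z * Complex.I))) (Metric.ball 0 δ) := by
    intro s δ h1 h2
    refine hd.comp (by fun_prop) fun z hz => ?_
    have hz' : |z.im| < δ := (Complex.abs_im_le_norm z).trans_lt (by simpa using hz)
    rw [abs_lt] at hz'
    simp only [horizontalStrip, Set.mem_ofPred_eq]
    have e : (-Complex.I * (s + z * Complex.I)).im = z.im - s := by simp; ring
    rw [e]; constructor <;> linarith
  -- `δ` is within the distances from both `0` and `β` to the ends of `(-M, -m)`. By convexity it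
  -- then serves at every `c * β` with `0 ≤ c ≤ 1`, so the step size never shrinks.
  obtain ⟨δ, hδ, hδ1, hδ2, hδ3, hδ4⟩ : ∃ δ > 0, δ ≤ M ∧ δ ≤ -m ∧ δ ≤ β + M ∧ δ ≤ -m - β := by
    refine ⟨min (min M (-m)) (min (β + M) (-m - β)), ?_, ?_, ?_, ?_, ?_⟩
    · simp only [gt_iff_lt, lt_min_iff]; refine ⟨⟨?_, ?_⟩, ?_, ?_⟩ <;> linarith
    all_goals simp
  have h0 : (0 : ℝ) ∈ interior (integrableExpSet id ν) := by
    refine Ioo_subset_integrableExpSet (s := 0) (δ := δ) (by simp [integrableExpSet])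
      (hball 0 δ (by linarith) (by linarith)) (fun t ht => ?_) ⟨by linarith, by linarith⟩
    rw [Complex.ofReal_zero, zero_add, complexMGF_id_mul_I, ← h]
    congr 1
    linear_combination (t : ℂ) * Complex.I_sq
  refine ⟨h0, ?_⟩
  have hstep : ∀ c : ℝ, 0 ≤ c → c ≤ 1 → c * β ∈ interior (integrableExpSet id ν) →
      Set.Ioo (c * β - δ) (c * β + δ) ⊆ interior (integrableExpSet id ν) := by
    intro c hc0 hc1 hc
    have b1 : δ ≤ c * β + M := by nlinarith
    have b2 : δ ≤ -m - c * β := by nlinarith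
    refine Ioo_subset_integrableExpSet (interior_subset hc) (hball (c * β) δ b1 b2) fun t _ => ?_
    have hre : (((c * β : ℝ) : ℂ) + t * Complex.I).re = c * β := by simp
    exact complexMGF_eq_of_charFun_eq hm hM hd h h0 (by rwa [hre])
      (by rw [hre]; constructor <;> linarith)
  -- `N` steps, each of length `|β| / N < δ`, lead from `0` to `β`.
  obtain ⟨N, hN⟩ := exists_nat_gt (|β| / δ)
  have hN0 : (0 : ℝ) < N := (by positivity : 0 ≤ |β| / δ).trans_lt hN
  have hall : ∀ k : ℕ, k ≤ N → (k / N : ℝ) * β ∈ interior (integrableExpSet id ν) := by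
    intro k
    induction k with
    | zero => intro _; simpa using h0
    | succ k ih =>
      intro hk
      have hk' : (k : ℝ) + 1 ≤ N := by exact_mod_cast hk
      refine hstep (k / N) (by positivity) ((div_le_one hN0).2 (by linarith)) (ih (by omega)) ?_
      have e : ((k + 1 : ℕ) / N : ℝ) * β = k / N * β + β / N := by push_cast; ring
      have hb : |β / N| < δ := by
        rw [abs_div, abs_of_pos hN0, div_lt_iff₀ hN0]
        rwa [div_lt_iff₀ hδ, mul_comm] at hN
      rw [abs_lt] at hb
      rw [e]; constructor <;> linarith
  have := hall N le_rfl
  rwa [div_self hN0.ne', one_mul] at this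

theorem CondPhiSym.integrable_exp {ν : Measure ℝ} [IsFiniteMeasure ν] {Φ : ℂ → ℂ} {β : ℝ}
    (hΦ : CondPhiSym ν Φ β) : Integrable (fun x => Real.exp (β * x)) ν := by
  obtain ⟨m, M, hm, hM, h1, h2, hd, h⟩ := hΦ.continuation
  have hβ : β ∈ integrableExpSet id ν :=
    interior_subset (mem_interior_integrableExpSet_of_charFun_eq hm hM hd h h1 h2).2
  exact hβ

theorem CondPhiSym.apply_linePt {ν : Measure ℝ} [IsFiniteMeasure ν] {Φ : ℂ → ℂ} {β : ℝ}
    (hΦ : CondPhiSym ν Φ β) (η : ℝ) :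
    Φ (linePt β η) = complexMGF id ν (β + η * Complex.I) := by
  obtain ⟨m, M, hm, hM, h1, h2, hd, h⟩ := hΦ.continuation
  obtain ⟨h0, hβ⟩ := mem_interior_integrableExpSet_of_charFun_eq hm hM hd h h1 h2
  have hre : ((β : ℂ) + η * Complex.I).re = β := by simp
  rw [complexMGF_eq_of_charFun_eq hm hM hd h h0 (by rwa [hre]) (by rw [hre]; exact ⟨h1, h2⟩)]
  congr 1
  rw [linePt]
  linear_combination (η : ℂ) * Complex.I_sq

/-! ### The random walk under an exponential tilt -/

section RandomWalk

variable {Ω : Type*} [MeasurableSpace Ω] {Q : Measure Ω} {Y : ℕ → Ω → ℝ}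

/-- The product rule for independent factors used here asks only for measurability, so no moment
condition on `z` is needed. -/
theorem IsIID.complexMGF_sum [IsProbabilityMeasure Q] (hY : IsIID Q Y) (z : ℂ) (n : ℕ) :
    complexMGF (fun w => ∑ j ∈ Finset.range n, Y j w) Q z = complexMGF (Y 0) Q z ^ n := by
  induction n with
  | zero => simp [complexMGF]
  | succ n ih =>
    have hmS : Measurable (fun w => ∑ j ∈ Finset.range n, Y j w) :=
      Finset.measurable_fun_sum _ fun j _ => hY.measurable j
    have hind : IndepFun (fun w => ∑ j ∈ Finset.range n, Y j w) (Y n) Q := by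
      have := hY.indep.indepFun_finsetSum_of_notMem hY.measurable
        (s := Finset.range n) (i := n) (by simp)
      convert this using 1
      ext w; simp
    have hexp : Measurable (fun x : ℝ => Complex.exp (z * x)) := by fun_prop
    have hc := hind.comp hexp hexp
    have := hc.integral_fun_mul_eq_mul_integral
      (hexp.comp hmS).aestronglyMeasurable (hexp.comp (hY.measurable n)).aestronglyMeasurable
    rw [pow_succ, ← ih, ← complexMGF_congr_identDistrib (hY.ident n), complexMGF, complexMGF,
      complexMGF]
    refine Eq.trans (integral_congr_ae (ae_of_all _ fun w => ?_)) this
    simp only [Function.comp, ← Complex.exp_add, Finset.sum_range_succ]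
    congr 1; push_cast; ring

theorem IsIID.integrable_exp_sum [IsProbabilityMeasure Q] (hY : IsIID Q Y) {β : ℝ}
    (hβ : Integrable (fun x => Real.exp (β * x)) (Q.map (Y 0))) (n : ℕ) :
    Integrable (fun w => Real.exp (β * ∑ j ∈ Finset.range n, Y j w)) Q := by
  have h0 : Integrable (fun w => Real.exp (β * Y 0 w)) Q :=
    hβ.comp_measurable (hY.measurable 0)
  have hj : ∀ j, Integrable (fun w => Real.exp (β * Y j w)) Q := fun j =>
    (((hY.ident j).comp (u := fun x => Real.exp (β * x)) (by fun_prop)).integrable_iff).2 h0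
  have := hY.indep.integrable_exp_mul_sum hY.measurable (s := Finset.range n) fun j _ => hj j
  simpa using this

/-- The law of `S` with density `exp (β s)`. -/
def tiltedLaw (Q : Measure Ω) (S : Ω → ℝ) (β : ℝ) : Measure ℝ :=
  (Q.map S).withDensity fun s => ENNReal.ofReal (Real.exp (β * s))

theorem isFiniteMeasure_tiltedLaw {S : Ω → ℝ} {β : ℝ} (hS : Measurable S)
    (h : Integrable (fun w => Real.exp (β * S w)) Q) : IsFiniteMeasure (tiltedLaw Q S β) := by
  refine isFiniteMeasure_withDensity_ofReal (Integrable.hasFiniteIntegral ?_)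
  exact (integrable_map_measure (by fun_prop) hS.aemeasurable).2 h

theorem charFun_tiltedLaw {S : Ω → ℝ} (hS : Measurable S) (β t : ℝ) :
    charFun (tiltedLaw Q S β) t = complexMGF S Q (β + t * Complex.I) := by
  rw [tiltedLaw, charFun_withDensity_exp, complexMGF_id_map hS.aemeasurable]

/-- The density `exp (β s)` and the damping `exp (-β (x + s))` multiply to `exp (-β x)`, a nonzero
constant in `s`. -/
theorem integrable_tiltedLaw_iff {S : Ω → ℝ} (hS : Measurable S) {G : ℝ → ℝ} (hG : Measurable G)
    (β x : ℝ) : Integrable (fun s => dampedPayoff G β (x + s)) (tiltedLaw Q S β) ↔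
      Integrable (fun w => G (x + S w)) Q := by
  have e : ∀ s, (ENNReal.ofReal (Real.exp (β * s))).toReal • dampedPayoff G β (x + s) =
      ((Real.exp (-(β * x)) * G (x + s) : ℝ) : ℂ) := by
    intro s
    rw [ENNReal.toReal_ofReal (Real.exp_pos _).le, dampedPayoff, Complex.real_smul,
      ← Complex.ofReal_mul, ← mul_assoc, ← Real.exp_add]
    congr 3; ring_nf
  rw [tiltedLaw, integrable_withDensity_iff_integrable_smul' (by fun_prop)
    (ae_of_all _ fun _ => ENNReal.ofReal_lt_top)]
  have hiff : ∀ f : ℝ → ℝ, Integrable (fun s => (f s : ℂ)) (Q.map S) ↔ Integrable f (Q.map S) :=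
    fun f => ⟨fun h => by simpa using h.re, fun h => h.ofReal⟩
  simp_rw [e]
  rw [hiff, integrable_const_mul_iff (Real.exp_pos _).ne'.isUnit,
    integrable_map_measure (by fun_prop : Measurable fun s => G (x + s)).aestronglyMeasurable
      hS.aemeasurable]
  rfl

theorem integral_tiltedLaw {S : Ω → ℝ} (hS : Measurable S) {G : ℝ → ℝ} (hG : Measurable G)
    (β x : ℝ) : ((∫ w, G (x + S w) ∂Q : ℝ) : ℂ) =
      (Real.exp (β * x) : ℂ) * ∫ s, dampedPayoff G β (x + s) ∂(tiltedLaw Q S β) := by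
  have e : ∀ s, (ENNReal.ofReal (Real.exp (β * s))).toReal • dampedPayoff G β (x + s) =
      ((Real.exp (-(β * x)) * G (x + s) : ℝ) : ℂ) := by
    intro s
    rw [ENNReal.toReal_ofReal (Real.exp_pos _).le, dampedPayoff, Complex.real_smul,
      ← Complex.ofReal_mul, ← mul_assoc, ← Real.exp_add]
    congr 3; ring_nf
  rw [tiltedLaw, integral_withDensity_eq_integral_toReal_smul (by fun_prop)
    (ae_of_all _ fun _ => ENNReal.ofReal_lt_top)]
  simp_rw [e]
  rw [integral_complex_ofReal, integral_const_mul, integral_map hS.aemeasurable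
    (by fun_prop : Measurable fun s => G (x + s)).aestronglyMeasurable, ← Complex.ofReal_mul,
    ← mul_assoc, ← Real.exp_add]
  simp

end RandomWalk

/-! ### Averages of translates of an `L²` function, and Plancherel -/

theorem integral_mul_norm_le_integral_sq_add_sq {ψ g : ℝ → ℂ} (hψ : MemLp ψ 2) (hg : MemLp g 2) :
    ∫ x, ‖ψ x * g x‖ ≤ (∫ x, ‖ψ x‖ ^ 2) + ∫ x, ‖g x‖ ^ 2 := by
  have h1 := (memLp_two_iff_integrable_sq_norm hψ.1).1 hψ
  have h2 := (memLp_two_iff_integrable_sq_norm hg.1).1 hg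
  rw [← integral_add h1 h2]
  refine integral_mono (hψ.integrable_mul hg).norm (h1.add h2) fun x => ?_
  simp only [norm_mul]
  nlinarith [sq_nonneg (‖ψ x‖ - ‖g x‖), norm_nonneg (ψ x), norm_nonneg (g x)]

section Translate

variable {μ : Measure ℝ} [IsFiniteMeasure μ] {g ψ : ℝ → ℂ}

theorem MeasureTheory.MemLp.comp_add_right_real (hg : MemLp g 2) (s : ℝ) :
    MemLp (fun x => g (x + s)) 2 :=
  hg.comp_measurePreserving (measurePreserving_add_right volume s)

/-- The `L²` norm is translation invariant, so the `x`-integrals of the norm are bounded uniformly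
in `s`, and `μ` is finite. -/
theorem integrable_prod_mul_translate (hgm : Measurable g) (hg : MemLp g 2) (hψm : Measurable ψ)
    (hψ : MemLp ψ 2) :
    Integrable (fun p : ℝ × ℝ => ψ p.1 * g (p.1 + p.2)) (volume.prod μ) := by
  have hm : Measurable fun p : ℝ × ℝ => ψ p.1 * g (p.1 + p.2) := by fun_prop
  rw [integrable_prod_iff' hm.aestronglyMeasurable]
  refine ⟨ae_of_all _ fun s => hψ.integrable_mul (hg.comp_add_right_real s), ?_⟩
  refine Integrable.of_bound (C := (∫ x, ‖ψ x‖ ^ 2) + ∫ x, ‖g x‖ ^ 2)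
    hm.norm.stronglyMeasurable.integral_prod_left'.aestronglyMeasurable
    (ae_of_all _ fun s => ?_)
  rw [Real.norm_of_nonneg (integral_nonneg fun x => norm_nonneg _)]
  refine (integral_mul_norm_le_integral_sq_add_sq hψ (hg.comp_add_right_real s)).trans_eq ?_
  rw [integral_add_right_eq_self (fun x => ‖g x‖ ^ 2) s]

/-- A nowhere vanishing `L²` weight used in place of cutoffs: it can be divided out pointwise, and
its reciprocal is continuous, which preserves local integrability. -/
theorem memLp_two_inv_one_add_sq : MemLp (fun x : ℝ => ((1 + x ^ 2)⁻¹ : ℂ)) 2 := by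
  have hm : Measurable fun x : ℝ => ((1 + x ^ 2)⁻¹ : ℂ) := by fun_prop
  rw [memLp_two_iff_integrable_sq_norm hm.aestronglyMeasurable]
  refine integrable_inv_one_add_sq.mono' (by fun_prop) (ae_of_all _ fun x => ?_)
  have e : ‖((1 + x ^ 2)⁻¹ : ℂ)‖ = (1 + x ^ 2)⁻¹ := by
    rw [show ((1 + x ^ 2)⁻¹ : ℂ) = (((1 + x ^ 2)⁻¹ : ℝ) : ℂ) by push_cast; rfl, Complex.norm_real,
      Real.norm_of_nonneg (by positivity)]
  rw [e, Real.norm_of_nonneg (by positivity)]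
  exact pow_le_of_le_one (by positivity) (inv_le_one_of_one_le₀ (by nlinarith [sq_nonneg x]))
    two_ne_zero

theorem one_add_sq_ofReal_ne_zero (x : ℝ) : (1 + x ^ 2 : ℂ) ≠ 0 := by
  exact_mod_cast (by positivity : (1 + x ^ 2 : ℝ) ≠ 0)

theorem ae_integrable_translate (hgm : Measurable g) (hg : MemLp g 2) :
    ∀ᵐ x : ℝ, Integrable (fun s => g (x + s)) μ := by
  filter_upwards [(integrable_prod_mul_translate (μ := μ) hgm hg (by fun_prop)
    memLp_two_inv_one_add_sq).prod_right_ae] with x hx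
  exact (integrable_const_mul_iff (inv_ne_zero (one_add_sq_ofReal_ne_zero x)).isUnit _).1 hx

theorem locallyIntegrable_integral_translate (hgm : Measurable g) (hg : MemLp g 2) :
    LocallyIntegrable (fun x : ℝ => ∫ s, g (x + s) ∂μ) := by
  have h := (integrable_prod_mul_translate (μ := μ) hgm hg (by fun_prop)
    memLp_two_inv_one_add_sq).integral_prod_left.locallyIntegrable
  have hc : Continuous fun x : ℝ => (1 + x ^ 2 : ℂ) := by fun_prop
  have := (locallyIntegrableOn_univ.2 h).continuousOn_mul hc.continuousOn isOpen_univ.isLocallyClosed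
  rw [locallyIntegrableOn_univ] at this
  refine this.congr (ae_of_all _ fun x => ?_)
  simp only
  rw [integral_const_mul, mul_inv_cancel_left₀ (one_add_sq_ofReal_ne_zero x)]

/-- The `L²` transform agrees with the transform of tempered distributions, which is defined by
duality; it is tested here on the Schwartz function `𝓕⁻ ψ`. -/
theorem integral_mul_eq_integral_fourierInv_mul_fourier (hψ : ContDiff ℝ ∞ ψ)
    (hψc : HasCompactSupport ψ) (f : Lp ℂ 2 (volume : Measure ℝ)) :
    ∫ x, ψ x * f x = ∫ t, 𝓕⁻ ψ t * (𝓕 f : Lp ℂ 2 (volume : Measure ℝ)) t := by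
  let S : SchwartzMap ℝ ℂ := hψc.toSchwartzMap hψ
  have h := congrArg (fun T : TemperedDistribution ℝ ℂ => T (𝓕⁻ S))
    (Lp.fourier_toTemperedDistribution_eq f)
  simp only [TemperedDistribution.fourier_apply, FourierTransform.fourier_fourierInv_eq,
    Lp.toTemperedDistribution_apply, smul_eq_mul, SchwartzMap.fourierInv_coe] at h
  exact h

theorem fourierInv_translate (s t : ℝ) :
    𝓕⁻ (fun x => ψ (x - s)) t = Complex.exp ((2 * Real.pi * t : ℝ) * s * Complex.I) * 𝓕⁻ ψ t := by
  rw [Real.fourierInv_eq', Real.fourierInv_eq', ← integral_const_mul,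
    ← integral_add_right_eq_self _ s]
  refine integral_congr_ae (ae_of_all _ fun x => ?_)
  simp only [add_sub_cancel_right, smul_eq_mul]
  rw [← mul_assoc, ← Complex.exp_add]
  congr 2
  simp
  ring

theorem memLp_two_fourierInv (hψ : ContDiff ℝ ∞ ψ) (hψc : HasCompactSupport ψ) :
    MemLp (𝓕⁻ ψ) 2 := by
  have := (𝓕⁻ (hψc.toSchwartzMap hψ)).memLp 2 volume
  rwa [SchwartzMap.fourierInv_coe] at this

/-- Plancherel's identity for the convolution of an `L²` function with a finite measure. -/
theorem integral_mul_integral_translate (hgm : Measurable g) (hg : MemLp g 2)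
    (hψ : ContDiff ℝ ∞ ψ) (hψc : HasCompactSupport ψ) :
    ∫ x, ψ x * ∫ s, g (x + s) ∂μ = ∫ t : ℝ, charFun μ (2 * Real.pi * t) *
      (𝓕⁻ ψ t * (𝓕 (hg.toLp g) : Lp ℂ 2 (volume : Measure ℝ)) t) := by
  have hψ2 : MemLp ψ 2 := hψ.continuous.memLp_of_hasCompactSupport hψc
  have hs : ∀ s : ℝ, ∫ x, ψ x * g (x + s) = ∫ t : ℝ,
      Complex.exp ((2 * Real.pi * t : ℝ) * s * Complex.I) *
        (𝓕⁻ ψ t * (𝓕 (hg.toLp g) : Lp ℂ 2 (volume : Measure ℝ)) t) := by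
    intro s
    -- The shift is moved to the test function, where it becomes a phase, so the `L²` transform of
    -- `g` stays fixed as `s` varies.
    have h1 : ∫ x, ψ x * g (x + s) = ∫ x, ψ (x - s) * (hg.toLp g) x := by
      rw [← integral_add_right_eq_self (fun x => ψ (x - s) * (hg.toLp g) x) s]
      have := (measurePreserving_add_right volume s).quasiMeasurePreserving.ae hg.coeFn_toLp
      refine integral_congr_ae ?_
      filter_upwards [this] with x hx
      rw [hx, add_sub_cancel_right]
    rw [h1, integral_mul_eq_integral_fourierInv_mul_fourier (ψ := fun x => ψ (x - s)) (by fun_prop)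
      (hψc.comp_homeomorph (Homeomorph.subRight s))]
    refine integral_congr_ae (ae_of_all _ fun t => ?_)
    simp only [fourierInv_translate, mul_assoc]
  calc ∫ x, ψ x * ∫ s, g (x + s) ∂μ
      = ∫ x, ∫ s, ψ x * g (x + s) ∂μ := by simp_rw [integral_const_mul]
    _ = ∫ s, (∫ x, ψ x * g (x + s)) ∂μ :=
        integral_integral_swap (integrable_prod_mul_translate hgm hg
          hψ.continuous.measurable hψ2)
    _ = ∫ s : ℝ, (∫ t : ℝ, Complex.exp ((2 * Real.pi * t : ℝ) * s * Complex.I) *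
        (𝓕⁻ ψ t * (𝓕 (hg.toLp g) : Lp ℂ 2 (volume : Measure ℝ)) t)) ∂μ := by simp_rw [hs]
    _ = ∫ t : ℝ, ∫ s : ℝ, Complex.exp ((2 * Real.pi * t : ℝ) * s * Complex.I) *
        (𝓕⁻ ψ t * (𝓕 (hg.toLp g) : Lp ℂ 2 (volume : Measure ℝ)) t) ∂μ := by
        refine integral_integral_swap ?_
        have hi : Integrable (fun t => 𝓕⁻ ψ t * (𝓕 (hg.toLp g) : Lp ℂ 2 (volume : Measure ℝ)) t) :=
          (memLp_two_fourierInv hψ hψc).integrable_mul (Lp.memLp _)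
        have hp := (integrable_const (μ := μ) (1 : ℂ)).mul_prod hi
        refine hp.mono (AEStronglyMeasurable.mul (by fun_prop) ?_) (ae_of_all _ fun p => ?_)
        · exact hi.1.comp_snd
        · simp only [Function.uncurry, norm_mul, norm_one]
          rw [← Complex.ofReal_mul, Complex.norm_exp_ofReal_mul_I]
    _ = _ := by
        refine integral_congr_ae (ae_of_all _ fun t => ?_)
        simp only
        rw [integral_mul_const, charFun_apply_real]

end Translate

/-! ### Cauchy's formula on a branch of a hyperbola -/

/-- The branch of a hyperbola `y ↦ p cosh y + i c sinh y`. -/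
def hyperbola (p c y : ℝ) : ℂ :=
  ((p * Real.cosh y : ℝ) : ℂ) + ((c * Real.sinh y : ℝ) : ℂ) * Complex.I

/-- The derivative of `hyperbola`. -/
def hyperbolaDeriv (p c y : ℝ) : ℂ :=
  ((p * Real.sinh y : ℝ) : ℂ) + ((c * Real.cosh y : ℝ) : ℂ) * Complex.I

section Hyperbola

open Filter Topology

variable {p c : ℝ}

@[simp] theorem hyperbola_re (p c y : ℝ) : (hyperbola p c y).re = p * Real.cosh y := by
  simp [hyperbola, -Complex.ofReal_mul]

@[simp] theorem hyperbola_im (p c y : ℝ) : (hyperbola p c y).im = c * Real.sinh y := by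
  simp [hyperbola, -Complex.ofReal_mul]

theorem hasDerivAt_hyperbola (p c y : ℝ) :
    HasDerivAt (hyperbola p c) (hyperbolaDeriv p c y) y :=
  (((Real.hasDerivAt_cosh y).const_mul p).ofReal_comp).add
    ((((Real.hasDerivAt_sinh y).const_mul c).ofReal_comp).mul_const Complex.I)

@[fun_prop] theorem continuous_hyperbola (p c : ℝ) : Continuous (hyperbola p c) :=
  continuous_iff_continuousAt.2 fun y => (hasDerivAt_hyperbola p c y).continuousAt

@[fun_prop] theorem continuous_hyperbolaDeriv (p c : ℝ) : Continuous (hyperbolaDeriv p c) := by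
  unfold hyperbolaDeriv; fun_prop

theorem le_norm_hyperbola (p c y : ℝ) : p * Real.cosh y ≤ ‖hyperbola p c y‖ := by
  simpa using Complex.re_le_norm (hyperbola p c y)

theorem hyperbola_ne_zero (hp : 0 < p) (y : ℝ) : hyperbola p c y ≠ 0 := by
  intro h
  have := congrArg Complex.re h
  simp only [hyperbola_re, Complex.zero_re] at this
  exact (mul_pos hp (Real.cosh_pos y)).ne' this

theorem norm_hyperbolaDeriv_le (hp : 0 < p) (hc : 0 < c) (y : ℝ) :
    ‖hyperbolaDeriv p c y‖ ≤ (p + c) * Real.cosh y := by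
  refine (norm_add_le _ _).trans ?_
  have h : |Real.sinh y| ≤ Real.cosh y :=
    abs_le_of_sq_le_sq (by rw [Real.cosh_sq]; linarith) (Real.cosh_pos y).le
  rw [norm_mul, Complex.norm_I, mul_one, Complex.norm_real, Complex.norm_real, norm_mul, norm_mul,
    Real.norm_of_nonneg hp.le, Real.norm_of_nonneg hc.le,
    Real.norm_of_nonneg (Real.cosh_pos y).le, Real.norm_eq_abs]
  nlinarith

theorem one_add_sq_le_two_mul_cosh (y : ℝ) : 1 + y ^ 2 ≤ 2 * Real.cosh y := by
  have h1 : Real.cosh y = 1 + 2 * Real.sinh (y / 2) ^ 2 := by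
    have := Real.cosh_two_mul (y / 2)
    rw [show 2 * (y / 2) = y by ring, Real.cosh_sq] at this
    linarith
  have h2 : (y / 2) ^ 2 ≤ Real.sinh (y / 2) ^ 2 := by
    rw [← sq_abs, ← sq_abs (Real.sinh _), Real.abs_sinh]
    exact pow_le_pow_left₀ (abs_nonneg _) (Real.self_le_sinh_iff.2 (abs_nonneg _)) 2
  nlinarith

/-- The integrand is of order `cosh y ^ (1 - n)`, so `n = 2` already leaves one factor `1 / cosh y`.
-/
theorem norm_inv_pow_mul_hyperbolaDeriv_le (hp : 0 < p) (hc : 0 < c) {n : ℕ} (hn : 2 ≤ n) (y : ℝ) :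
    ‖(hyperbola p c y ^ n)⁻¹ * hyperbolaDeriv p c y‖ ≤ 2 * (p + c) / p ^ n * (1 + y ^ 2)⁻¹ := by
  have hch := Real.cosh_pos y
  have h1 : (p * Real.cosh y) ^ n ≤ ‖hyperbola p c y ^ n‖ := by
    rw [norm_pow]; exact pow_le_pow_left₀ (by positivity) (le_norm_hyperbola p c y) n
  have h2 : Real.cosh y ^ 2 ≤ Real.cosh y ^ n := pow_le_pow_right₀ (Real.one_le_cosh y) hn
  rw [norm_mul, norm_inv]
  calc ‖hyperbola p c y ^ n‖⁻¹ * ‖hyperbolaDeriv p c y‖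
      ≤ (p ^ n * Real.cosh y ^ 2)⁻¹ * ((p + c) * Real.cosh y) := by
        refine mul_le_mul (inv_anti₀ (by positivity) ?_) (norm_hyperbolaDeriv_le hp hc y)
          (norm_nonneg _) (by positivity)
        rw [mul_pow] at h1
        exact (mul_le_mul_of_nonneg_left h2 (by positivity)).trans h1
    _ = 2 * (p + c) / p ^ n * (2 * Real.cosh y)⁻¹ := by field_simp
    _ ≤ _ := by
        refine mul_le_mul_of_nonneg_left (inv_anti₀ (by positivity)
          (one_add_sq_le_two_mul_cosh y)) (by positivity)

/-- The hyperbola stays away from the reciprocals of the numbers in `[0, m]` if `p m < 1`. -/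
theorem exists_le_norm_one_sub_hyperbola_mul (hp : 0 < p) (hc : 0 < c) {m : ℝ} (hm : p * m < 1) :
    ∃ d > 0, ∀ y f : ℝ, 0 ≤ f → f ≤ m → d ≤ ‖1 - hyperbola p c y * f‖ := by
  -- Compare `p f cosh y` with the midpoint of `p m` and `1`. Below it the real part is at least `(1
  -- - p m) / 2`; above it `cosh ^ 2 - sinh ^ 2 = 1` bounds the imaginary part from below by the
  -- second entry.
  refine ⟨min ((1 - p * m) / 2) (c / p * ((1 - p * m) / 2)), ?_, fun y f hf hfm => ?_⟩
  · have : 0 < 1 - p * m := by linarith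
    exact lt_min (by positivity) (by positivity)
  have ham : 0 ≤ p * m := mul_nonneg hp.le (hf.trans hfm)
  have hre : (1 - hyperbola p c y * f).re = 1 - p * Real.cosh y * f := by simp
  have him : (1 - hyperbola p c y * f).im = -(c * Real.sinh y * f) := by simp
  rcases le_total (p * Real.cosh y * f) ((1 + p * m) / 2) with h | h
  · refine (min_le_left _ _).trans (le_trans ?_ (Complex.re_le_norm _))
    rw [hre]; linarith
  · refine (min_le_right _ _).trans (le_trans ?_ (Complex.abs_im_le_norm _))
    rw [him, abs_neg]
    refine (le_abs_self _).trans (sq_le_sq.1 ?_)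
    have hfa : p * f ≤ p * m := mul_le_mul_of_nonneg_left hfm hp.le
    have hfa0 : 0 ≤ p * f := mul_nonneg hp.le hf
    have e : (c * Real.sinh y * f) ^ 2 = (c / p) ^ 2 * ((p * Real.cosh y * f) ^ 2 - (p * f) ^ 2) := by
      rw [mul_pow, mul_pow, Real.sinh_sq]; field_simp
    rw [e, mul_pow]
    refine mul_le_mul_of_nonneg_left ?_ (sq_nonneg _)
    have h3 : ((1 + p * m) / 2) ^ 2 ≤ (p * Real.cosh y * f) ^ 2 :=
      pow_le_pow_left₀ (by positivity) h 2
    have h4 : (p * f) ^ 2 ≤ (p * m) ^ 2 := pow_le_pow_left₀ hfa0 hfa 2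
    nlinarith

theorem tendsto_inv_hyperbola (hp : 0 < p) :
    Tendsto (fun y => (hyperbola p c y)⁻¹) (cocompact ℝ) (𝓝 0) := by
  refine tendsto_inv₀_cobounded.comp (tendsto_norm_atTop_iff_cobounded.1 ?_)
  refine tendsto_atTop_mono (fun y => ?_)
    ((tendsto_norm_cocompact_atTop (E := ℝ)).const_mul_atTop hp)
  refine le_trans (mul_le_mul_of_nonneg_left ?_ hp.le) (le_norm_hyperbola p c y)
  rw [Real.norm_eq_abs]
  have := one_add_sq_le_two_mul_cosh y
  nlinarith [sq_abs y, sq_nonneg (|y| - 1)]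

theorem integrable_inv_pow_mul_hyperbolaDeriv (hp : 0 < p) (hc : 0 < c) {n : ℕ} (hn : 2 ≤ n) :
    Integrable fun y => (hyperbola p c y ^ n)⁻¹ * hyperbolaDeriv p c y := by
  refine (integrable_inv_one_add_sq.const_mul (2 * (p + c) / p ^ n)).mono' ?_
    (ae_of_all _ fun y => norm_inv_pow_mul_hyperbolaDeriv_le hp hc hn y)
  refine Continuous.aestronglyMeasurable (Continuous.mul (Continuous.inv₀ (by fun_prop) ?_)
    (by fun_prop))
  exact fun y => pow_ne_zero _ (hyperbola_ne_zero hp y)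

/-- The primitive `-q ^ (1 - n) / (n - 1)` vanishes at both ends of the contour. -/
theorem integral_inv_pow_mul_hyperbolaDeriv (hp : 0 < p) (hc : 0 < c) {n : ℕ} (hn : 2 ≤ n) :
    ∫ y, (hyperbola p c y ^ n)⁻¹ * hyperbolaDeriv p c y = 0 := by
  obtain ⟨k, rfl⟩ : ∃ k, n = k + 2 := ⟨n - 2, by omega⟩
  have hk : ((k : ℂ) + 1) ≠ 0 := by exact_mod_cast k.succ_ne_zero
  have hlim : Tendsto (fun y => -((hyperbola p c y)⁻¹ ^ (k + 1)) / ((k : ℂ) + 1)) (cocompact ℝ)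
      (𝓝 0) := by
    simpa using (((tendsto_inv_hyperbola (c := c) hp).pow (k + 1)).neg).div_const ((k : ℂ) + 1)
  rw [integral_of_hasDerivAt_of_tendsto (fun y => ?_)
    (integrable_inv_pow_mul_hyperbolaDeriv hp hc hn) (hlim.mono_left atBot_le_cocompact)
    (hlim.mono_left atTop_le_cocompact), sub_zero]
  have h0 := hyperbola_ne_zero (c := c) hp y
  have := ((((hasDerivAt_hyperbola p c y).inv h0).pow (k + 1)).neg).div_const ((k : ℂ) + 1)
  refine this.congr_deriv ?_
  simp only [Pi.inv_apply, inv_pow]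
  push_cast
  field_simp
  ring

theorem log_neg_of_im_pos {u : ℂ} (hu : 0 < u.im) :
    Complex.log (-u) = Complex.log u - Real.pi * Complex.I := by
  rw [Complex.log, Complex.log, norm_neg, Complex.arg_neg_eq_arg_sub_pi_of_im_pos hu]
  push_cast; ring

/-- The imaginary part vanishes only for `y = 0` or `f = 0`, and there the real part is positive.
Hence the principal logarithm is differentiable along the whole curve. -/
theorem one_sub_hyperbola_mul_mem_slitPlane (hc : 0 < c) {f : ℝ}
    (hfp : p * f < 1) (y : ℝ) : 1 - hyperbola p c y * f ∈ Complex.slitPlane := by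
  rw [Complex.mem_slitPlane_iff]
  rcases eq_or_ne (Real.sinh y * f) 0 with h | h
  · left
    have : (1 - hyperbola p c y * f).re = 1 - p * Real.cosh y * f := by simp
    rw [this]
    rcases mul_eq_zero.1 h with h | h
    · rw [Real.sinh_eq_zero] at h
      simpa [h] using hfp
    · simp [h]
  · right
    have : (1 - hyperbola p c y * f).im = -(c * (Real.sinh y * f)) := by simp [mul_assoc]
    rw [this]
    exact neg_ne_zero.2 (mul_ne_zero hc.ne' h)

theorem hyperbola_mem_slitPlane (hp : 0 < p) (y : ℝ) : hyperbola p c y ∈ Complex.slitPlane := by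
  left; simpa using mul_pos hp (Real.cosh_pos y)

theorem tendsto_exp_neg_mul_hyperbola (p c : ℝ) :
    Tendsto (fun y => ((Real.exp (-y) : ℝ) : ℂ) * hyperbola p c y) atTop
      (𝓝 (((p / 2 : ℝ) : ℂ) + ((c / 2 : ℝ) : ℂ) * Complex.I)) := by
  have h : Tendsto (fun y : ℝ => Real.exp (-y) * Real.exp (-y)) atTop (𝓝 0) := by
    simpa using (Real.tendsto_exp_neg_atTop_nhds_zero).mul Real.tendsto_exp_neg_atTop_nhds_zero
  have h1 : Tendsto (fun y : ℝ => Real.exp (-y) * (p * Real.cosh y)) atTop (𝓝 (p / 2)) := by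
    have : Tendsto (fun y : ℝ => p / 2 * (1 + Real.exp (-y) * Real.exp (-y))) atTop
        (𝓝 (p / 2 * (1 + 0))) := (h.const_add 1).const_mul _
    rw [add_zero, mul_one] at this
    refine this.congr fun y => ?_
    rw [Real.cosh_eq, Real.exp_neg]; field_simp
  have h2 : Tendsto (fun y : ℝ => Real.exp (-y) * (c * Real.sinh y)) atTop (𝓝 (c / 2)) := by
    have : Tendsto (fun y : ℝ => c / 2 * (1 - Real.exp (-y) * Real.exp (-y))) atTop
        (𝓝 (c / 2 * (1 - 0))) := (h.const_sub 1).const_mul _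
    rw [sub_zero, mul_one] at this
    refine this.congr fun y => ?_
    rw [Real.sinh_eq, Real.exp_neg]; field_simp
  have h1' := (Complex.continuous_ofReal.tendsto _).comp h1
  have h2' := ((Complex.continuous_ofReal.tendsto _).comp h2).mul_const Complex.I
  refine (h1'.add h2').congr fun y => ?_
  simp only [Function.comp, hyperbola]
  push_cast; ring

/-- Scaling both arguments by `exp (-y) > 0` does not change the difference of logarithms. The
scaled arguments tend to `u` in the upper half-plane and to `-f u` in the lower one; the term `π i`
comes from `log (-u) = log u - π i`. -/
theorem tendsto_log_sub_log_atTop (hp : 0 < p) (hc : 0 < c) {f : ℝ} (hf : 0 < f)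
    (hfp : p * f < 1) :
    Tendsto (fun y => Complex.log (hyperbola p c y) - Complex.log (1 - hyperbola p c y * f)) atTop
      (𝓝 (-(Real.log f : ℂ) + Real.pi * Complex.I)) := by
  set u : ℂ := ((p / 2 : ℝ) : ℂ) + ((c / 2 : ℝ) : ℂ) * Complex.I with hu
  have hure : u.re = p / 2 := by simp [hu, -Complex.ofReal_div]
  have huim : u.im = c / 2 := by simp [hu, -Complex.ofReal_div]
  have hu0 : 0 < u.im := by rw [huim]; positivity
  have hA := tendsto_exp_neg_mul_hyperbola p c
  have hB : Tendsto (fun y => ((Real.exp (-y) : ℝ) : ℂ) * (1 - hyperbola p c y * f)) atTop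
      (𝓝 ((f : ℂ) * -u)) := by
    have h0 := (Complex.continuous_ofReal.tendsto _).comp Real.tendsto_exp_neg_atTop_nhds_zero
    have := h0.sub (hA.mul_const (f : ℂ))
    rw [Complex.ofReal_zero, zero_sub] at this
    rw [show (f : ℂ) * -u = -(u * f) by ring]
    refine this.congr fun y => ?_
    simp only [Function.comp]
    ring
  have hlim : Complex.log u - Complex.log ((f : ℂ) * -u) =
      -(Real.log f : ℂ) + Real.pi * Complex.I := by
    rw [Complex.log_ofReal_mul hf (neg_ne_zero.2 fun h => by simp [h] at hu0),
      log_neg_of_im_pos hu0]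
    ring
  rw [← hlim]
  have h1 : u ∈ Complex.slitPlane := Or.inr hu0.ne'
  have h2 : (f : ℂ) * -u ∈ Complex.slitPlane := by
    right
    have : ((f : ℂ) * -u).im = -(f * u.im) := by simp
    rw [this]
    exact neg_ne_zero.2 (mul_pos hf hu0).ne'
  refine ((hA.clog h1).sub (hB.clog h2)).congr fun y => ?_
  rw [Complex.log_ofReal_mul (Real.exp_pos _) (hyperbola_ne_zero hp y),
    Complex.log_ofReal_mul (Real.exp_pos _)
      (Complex.slitPlane_ne_zero (one_sub_hyperbola_mul_mem_slitPlane hc hfp y))]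
  ring

/-- Reflection `y ↦ -y` conjugates the hyperbola, so this limit is the conjugate of the one at `+∞`.
-/
theorem tendsto_log_sub_log_atBot (hp : 0 < p) (hc : 0 < c) {f : ℝ} (hf : 0 < f)
    (hfp : p * f < 1) :
    Tendsto (fun y => Complex.log (hyperbola p c y) - Complex.log (1 - hyperbola p c y * f)) atBot
      (𝓝 (-(Real.log f : ℂ) - Real.pi * Complex.I)) := by
  have h := ((Complex.continuous_conj.tendsto _).comp
    (tendsto_log_sub_log_atTop hp hc hf hfp)).comp tendsto_neg_atBot_atTop
  have e : (starRingEnd ℂ) (-(Real.log f : ℂ) + Real.pi * Complex.I) =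
      -(Real.log f : ℂ) - Real.pi * Complex.I := by
    simp [sub_eq_add_neg]
  rw [e] at h
  refine h.congr fun y => ?_
  have ec : hyperbola p c (-y) = (starRingEnd ℂ) (hyperbola p c y) := by
    apply Complex.ext <;> simp
  have ed : 1 - hyperbola p c (-y) * f = (starRingEnd ℂ) (1 - hyperbola p c y * f) := by
    rw [ec]; simp
  simp only [Function.comp]
  rw [ed, ec, Complex.log_conj _ (Complex.slitPlane_arg_ne_pi (hyperbola_mem_slitPlane hp y)),
    Complex.log_conj _ (Complex.slitPlane_arg_ne_pi
      (one_sub_hyperbola_mul_mem_slitPlane hc hfp y))]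
  simp

theorem integrable_resolvent_hyperbola (hp : 0 < p) (hc : 0 < c) {f : ℝ} (hf : 0 ≤ f)
    (hfp : p * f < 1) {n : ℕ} (hn : 2 ≤ n) :
    Integrable fun y => (hyperbola p c y ^ n)⁻¹ * (f / (1 - hyperbola p c y * f)) *
      hyperbolaDeriv p c y := by
  obtain ⟨d, hd, hdle⟩ := exists_le_norm_one_sub_hyperbola_mul hp hc hfp
  have := (integrable_inv_pow_mul_hyperbolaDeriv hp hc hn).bdd_mul
    (f := fun y => (f / (1 - hyperbola p c y * f) : ℂ)) (c := f / d) ?_ (ae_of_all _ fun y => ?_)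
  · refine this.congr (ae_of_all _ fun y => ?_)
    simp only; ring
  · refine Continuous.aestronglyMeasurable (Continuous.div (by fun_prop) (by fun_prop) fun y => ?_)
    exact Complex.slitPlane_ne_zero (one_sub_hyperbola_mul_mem_slitPlane hc hfp y)
  · rw [norm_div, Complex.norm_real, Real.norm_of_nonneg hf]
    exact div_le_div_of_nonneg_left hf hd (hdle y f hf le_rfl)

/-- Cauchy's integral formula for the coefficients of `f / (1 - q f)` on a branch of a hyperbola
that separates `0` from `1 / f`. -/
theorem integral_resolvent_hyperbola (hp : 0 < p) (hc : 0 < c) {f : ℝ} (hf : 0 ≤ f)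
    (hfp : p * f < 1) {n : ℕ} (hn : 2 ≤ n) :
    ∫ y, (hyperbola p c y ^ n)⁻¹ * (f / (1 - hyperbola p c y * f)) * hyperbolaDeriv p c y =
      2 * Real.pi * Complex.I * f ^ n := by
  rcases hf.eq_or_lt with rfl | hf0
  · simp [show n ≠ 0 by omega]
  have hs := one_sub_hyperbola_mul_mem_slitPlane hc hfp
  induction n, hn using Nat.le_induction with
  | base =>
    have hz := (tendsto_inv_hyperbola (c := c) hp).const_mul (-(f : ℂ))
    -- Partial fractions: `f / (q ^ 2 (1 - q f)) = f / q ^ 2 + f ^ 2 (1 / q + f / (1 - q f))`. The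
    -- rational part of the primitive vanishes at both ends, and the logarithms differ by `2 π i`.
    have hderiv : ∀ y, HasDerivAt (fun y => -(f : ℂ) * (hyperbola p c y)⁻¹ + (f : ℂ) ^ 2 *
        (Complex.log (hyperbola p c y) - Complex.log (1 - hyperbola p c y * f)))
        ((hyperbola p c y ^ 2)⁻¹ * (f / (1 - hyperbola p c y * f)) * hyperbolaDeriv p c y) y := by
      intro y
      have h0 := hyperbola_ne_zero (c := c) hp y
      have h1 := Complex.slitPlane_ne_zero (hs y)
      have hd := hasDerivAt_hyperbola p c y
      refine (((hd.inv h0).const_mul (-(f : ℂ))).add (((hd.clog_real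
        (hyperbola_mem_slitPlane hp y)).sub (((hd.mul_const (f : ℂ)).const_sub 1).clog_real
        (hs y))).const_mul ((f : ℂ) ^ 2))).congr_deriv ?_
      generalize hD : 1 - hyperbola p c y * f = D at h1
      field_simp
      rw [← hD]
      ring
    rw [integral_of_hasDerivAt_of_tendsto hderiv
      (integrable_resolvent_hyperbola hp hc hf hfp le_rfl)
      ((hz.mono_left atBot_le_cocompact).add
        ((tendsto_log_sub_log_atBot hp hc hf0 hfp).const_mul _))
      ((hz.mono_left atTop_le_cocompact).add
        ((tendsto_log_sub_log_atTop hp hc hf0 hfp).const_mul _))]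
    ring
  | succ n hn ih =>
    -- From `1 / (1 - q f) = 1 + q f / (1 - q f)`: the first summand integrates to zero, the second
    -- is `f` times the case `n`.
    have e : ∀ y, (hyperbola p c y ^ (n + 1))⁻¹ * (f / (1 - hyperbola p c y * f)) *
        hyperbolaDeriv p c y = f * ((hyperbola p c y ^ (n + 1))⁻¹ * hyperbolaDeriv p c y) +
        f * ((hyperbola p c y ^ n)⁻¹ * (f / (1 - hyperbola p c y * f)) * hyperbolaDeriv p c y) := by
      intro y
      have h0 := hyperbola_ne_zero (c := c) hp y
      have h1 := Complex.slitPlane_ne_zero (hs y)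
      generalize hD : 1 - hyperbola p c y * f = D at h1
      field_simp
      rw [← hD]
      ring
    simp_rw [e]
    rw [integral_add ((integrable_inv_pow_mul_hyperbolaDeriv hp hc (by omega)).const_mul _)
      ((integrable_resolvent_hyperbola hp hc hf hfp hn).const_mul _), integral_const_mul,
      integral_const_mul, ih, integral_inv_pow_mul_hyperbolaDeriv hp hc (by omega)]
    ring

end Hyperbola

/-! ### Fourier inversion on the line `Im ξ = -β` -/

theorem norm_exp_I_mul_linePt (β x η : ℝ) :
    ‖Complex.exp (Complex.I * x * linePt β η)‖ = Real.exp (β * x) := by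
  rw [Complex.norm_exp]
  congr 1
  simp [linePt]
  ring

theorem exp_I_mul_linePt (β x η : ℝ) :
    Complex.exp (Complex.I * x * linePt β η) =
      (Real.exp (β * x) : ℂ) * Complex.exp ((x * η : ℝ) * Complex.I) := by
  rw [Complex.ofReal_exp, ← Complex.exp_add]
  congr 1
  rw [linePt]; push_cast
  linear_combination (-(x : ℂ) * β) * Complex.I_sq

theorem continuous_linePt (β : ℝ) : Continuous (linePt β) := by
  unfold linePt; fun_prop

theorem testTransform_linePt (φ : ℝ → ℂ) (β η : ℝ) :
    testTransform φ (linePt β η) =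
      𝓕⁻ (fun x : ℝ => (Real.exp (β * x) : ℂ) * φ x) (η / (2 * Real.pi)) := by
  rw [testTransform, Real.fourierInv_eq']
  refine integral_congr_ae (ae_of_all _ fun x => ?_)
  simp only [smul_eq_mul, exp_I_mul_linePt]
  rw [mul_comm (Real.exp (β * x) : ℂ), mul_assoc]
  congr 2
  simp
  field_simp

section Pairing

variable {G : ℝ → ℝ} {β : ℝ} {φ : ℝ → ℂ}

theorem contDiff_exp_mul (hφ : ContDiff ℝ ∞ φ) (β : ℝ) :
    ContDiff ℝ ∞ fun x : ℝ => (Real.exp (β * x) : ℂ) * φ x := by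
  have : ContDiff ℝ ∞ fun x : ℝ => (Real.exp (β * x) : ℂ) :=
    Complex.ofRealCLM.contDiff.comp (by fun_prop : ContDiff ℝ ∞ fun x : ℝ => Real.exp (β * x))
  exact this.mul hφ

theorem testTransform_mul_payoffFourier_eq (hG : CondG G β) (φ : ℝ → ℂ) (η : ℝ) :
    testTransform φ (linePt β η) * payoffFourier hG η =
      (fun t => 𝓕⁻ (fun x : ℝ => (Real.exp (β * x) : ℂ) * φ x) t *
        (𝓕 (hG.memLp.toLp (dampedPayoff G β)) : Lp ℂ 2 (volume : Measure ℝ)) t)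
        (η / (2 * Real.pi)) := by
  rw [testTransform_linePt, payoffFourier]

theorem integrable_testTransform_mul_payoffFourier (hG : CondG G β) (hφ : ContDiff ℝ ∞ φ)
    (hφc : HasCompactSupport φ) :
    Integrable fun η => testTransform φ (linePt β η) * payoffFourier hG η := by
  simp_rw [testTransform_mul_payoffFourier_eq hG φ]
  have h2 := Lp.memLp (𝓕 (hG.memLp.toLp (dampedPayoff G β)) : Lp ℂ 2 (volume : Measure ℝ))
  have h1 : MemLp (𝓕⁻ fun x : ℝ => (Real.exp (β * x) : ℂ) * φ x) 2 :=
    memLp_two_fourierInv (contDiff_exp_mul hφ β) hφc.mul_left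
  exact (h1.integrable_mul h2).comp_div Real.two_pi_pos.ne'

theorem measurable_dampedPayoff (hG : Measurable G) : Measurable (dampedPayoff G β) := by
  unfold dampedPayoff
  exact Complex.measurable_ofReal.comp (by fun_prop)

theorem locallyIntegrable_exp_mul_translate (hG : CondG G β) (μ : Measure ℝ) [IsFiniteMeasure μ] :
    LocallyIntegrable fun x : ℝ =>
      (Real.exp (β * x) : ℂ) * ∫ s, dampedPayoff G β (x + s) ∂μ := by
  have hc : Continuous fun x : ℝ => (Real.exp (β * x) : ℂ) := by fun_prop
  have := (locallyIntegrableOn_univ.2 (locallyIntegrable_integral_translate (μ := μ)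
    (measurable_dampedPayoff hG.measurable) hG.memLp)).continuousOn_mul hc.continuousOn
    isOpen_univ.isLocallyClosed
  rwa [locallyIntegrableOn_univ] at this

/-- The convolution of the payoff with a tilted law, paired with a test function. -/
theorem integral_exp_mul_translate_mul (hG : CondG G β) (hφ : ContDiff ℝ ∞ φ)
    (hφc : HasCompactSupport φ) (μ : Measure ℝ) [IsFiniteMeasure μ] :
    ∫ x : ℝ, ((Real.exp (β * x) : ℂ) * ∫ s, dampedPayoff G β (x + s) ∂μ) * φ x =
      1 / (2 * (Real.pi : ℂ)) * ∫ η, charFun μ η *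
        (testTransform φ (linePt β η) * payoffFourier hG η) := by
  have h := integral_mul_integral_translate (μ := μ) (measurable_dampedPayoff hG.measurable)
    hG.memLp (contDiff_exp_mul hφ β) hφc.mul_left
  have h2 := Measure.integral_comp_div (fun t : ℝ => charFun μ (2 * Real.pi * t) *
    (𝓕⁻ (fun x : ℝ => (Real.exp (β * x) : ℂ) * φ x) t *
      (𝓕 (hG.memLp.toLp (dampedPayoff G β)) : Lp ℂ 2 (volume : Measure ℝ)) t)) (2 * Real.pi)
  rw [← h, abs_of_pos Real.two_pi_pos] at h2
  have e : ∀ η : ℝ, 2 * Real.pi * (η / (2 * Real.pi)) = η := fun η => by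
    field_simp
  simp_rw [e, ← testTransform_mul_payoffFourier_eq hG φ] at h2
  rw [h2, Complex.real_smul, ← mul_assoc]
  have e2 : 1 / (2 * (Real.pi : ℂ)) * ((2 * Real.pi : ℝ) : ℂ) = 1 := by
    push_cast
    exact one_div_mul_cancel (by exact_mod_cast Real.two_pi_pos.ne')
  rw [e2, one_mul]
  refine integral_congr_ae (ae_of_all _ fun x => ?_)
  simp only; ring

/-- The inverse Fourier transform along the line `Im ξ = -β` is continuous. -/
theorem continuous_integral_exp_mul {h : ℝ → ℂ} (hh : Integrable h) (β : ℝ) :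
    Continuous fun x : ℝ => ∫ η, Complex.exp (Complex.I * x * linePt β η) * h η := by
  have e : ∀ x : ℝ, ∫ η, Complex.exp (Complex.I * x * linePt β η) * h η =
      (Real.exp (β * x) : ℂ) * ∫ η : ℝ, Complex.exp ((x * η : ℝ) * Complex.I) * h η := by
    intro x
    simp_rw [exp_I_mul_linePt, mul_assoc]
    rw [integral_const_mul]
  simp_rw [e]
  refine Continuous.mul (by fun_prop) (continuous_of_dominated (bound := fun η => ‖h η‖)
    (fun x => ?_) (fun x => ae_of_all _ fun η => ?_) hh.norm (ae_of_all _ fun η => by fun_prop))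
  · exact AEStronglyMeasurable.mul (by fun_prop) hh.1
  · rw [norm_mul, Complex.norm_exp_ofReal_mul_I, one_mul]

theorem integral_integral_exp_mul {h : ℝ → ℂ} (hh : Integrable h) (β : ℝ)
    (hφ : Continuous φ) (hφc : HasCompactSupport φ) :
    ∫ x : ℝ, (∫ η, Complex.exp (Complex.I * x * linePt β η) * h η) * φ x =
      ∫ η, testTransform φ (linePt β η) * h η := by
  have hc := continuous_linePt β
  simp_rw [testTransform, ← integral_mul_const]
  rw [integral_integral_swap]
  · refine integral_congr_ae (ae_of_all _ fun η => integral_congr_ae (ae_of_all _ fun x => ?_))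
    simp only; ring
  · have hi : Integrable fun x : ℝ => (Real.exp (β * x) : ℂ) * φ x :=
      Continuous.integrable_of_hasCompactSupport (by fun_prop) hφc.mul_left
    have hp := hi.mul_prod hh
    refine hp.mono ?_ (ae_of_all _ fun z => ?_)
    · refine AEStronglyMeasurable.mul (AEStronglyMeasurable.mul ?_ hh.1.comp_snd) ?_
      · exact Continuous.aestronglyMeasurable (by fun_prop)
      · exact Continuous.aestronglyMeasurable (by fun_prop)
    · simp only [Function.uncurry, norm_mul, norm_exp_I_mul_linePt, Complex.norm_real,
        Real.norm_eq_abs, Real.abs_exp]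
      exact le_of_eq (by ring)

/-- Pointwise Fourier inversion for the convolution of the payoff with a tilted law. -/
theorem ae_exp_mul_translate_eq (hG : CondG G β) (μ : Measure ℝ) [IsFiniteMeasure μ]
    (hi : Integrable fun η => charFun μ η * payoffFourier hG η) :
    ∀ᵐ x : ℝ, (Real.exp (β * x) : ℂ) * ∫ s, dampedPayoff G β (x + s) ∂μ =
      1 / (2 * (Real.pi : ℂ)) * ∫ η, Complex.exp (Complex.I * x * linePt β η) *
        (charFun μ η * payoffFourier hG η) := by
  -- Both sides are locally integrable, so it suffices to compare them against real test functions.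
  refine ae_eq_of_integral_contDiff_smul_eq ?_ ?_ fun g hg hgc => ?_
  · exact locallyIntegrable_exp_mul_translate hG μ
  · exact (continuous_const.mul (continuous_integral_exp_mul hi β)).locallyIntegrable
  · have hφ : ContDiff ℝ ∞ fun x => (g x : ℂ) := Complex.ofRealCLM.contDiff.comp hg
    have hφc : HasCompactSupport fun x => (g x : ℂ) := hgc.comp_left Complex.ofReal_zero
    have h1 := integral_exp_mul_translate_mul hG hφ hφc μ
    have h2 := integral_integral_exp_mul hi β hφ.continuous hφc
    simp_rw [Complex.real_smul, mul_comm (g _ : ℂ)]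
    rw [h1]
    simp_rw [mul_assoc (1 / (2 * (Real.pi : ℂ)))]
    rw [integral_const_mul, h2]
    congr 1
    refine integral_congr_ae (ae_of_all _ fun η => ?_)
    simp only; ring

end Pairing

/-! ### Exchanging the contour integral with the integral over the line -/

section Contour

variable {p c m : ℝ} {f : ℝ → ℝ} {K : ℝ → ℂ}

theorem integrable_resolvent_mul (hp : 0 < p) (hc : 0 < c) (hm : p * m < 1) (hfm : Measurable f)
    (hf : ∀ η, 0 ≤ f η ∧ f η ≤ m) (hK : Integrable fun η => f η * K η) (y : ℝ) :
    Integrable fun η => f η * K η / (1 - hyperbola p c y * f η) := by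
  obtain ⟨d, hd, hdle⟩ := exists_le_norm_one_sub_hyperbola_mul hp hc hm
  simp_rw [div_eq_inv_mul]
  refine hK.bdd_mul (c := d⁻¹) ?_ (ae_of_all _ fun η => ?_)
  · exact Measurable.aestronglyMeasurable (by fun_prop)
  · rw [norm_inv]
    exact inv_anti₀ hd (hdle y _ (hf η).1 (hf η).2)

/-- The bound `d` on `1 - q f` is uniform in both variables, so the integrand is dominated by a
product of an integrable function of `y` and one of `η`. Only `f K`, not `K`, has to be integrable.
-/
theorem integrable_prod_resolvent_mul (hp : 0 < p) (hc : 0 < c) (hm : p * m < 1)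
    (hfm : Measurable f) (hf : ∀ η, 0 ≤ f η ∧ f η ≤ m) (hK : Integrable fun η => f η * K η)
    {n : ℕ} (hn : 2 ≤ n) :
    Integrable (fun z : ℝ × ℝ => (hyperbola p c z.1 ^ n)⁻¹ *
      (f z.2 * K z.2 / (1 - hyperbola p c z.1 * f z.2)) * hyperbolaDeriv p c z.1)
      (volume.prod volume) := by
  obtain ⟨d, hd, hdle⟩ := exists_le_norm_one_sub_hyperbola_mul hp hc hm
  have h := (integrable_inv_pow_mul_hyperbolaDeriv hp hc hn).mul_prod hK
  have h2 := h.bdd_mul (f := fun z : ℝ × ℝ => (1 - hyperbola p c z.1 * f z.2)⁻¹) (c := d⁻¹) ?_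
    (ae_of_all _ fun z => ?_)
  · refine h2.congr (ae_of_all _ fun z => ?_)
    simp only [div_eq_mul_inv]; ring
  · have := (continuous_hyperbola p c).measurable
    exact Measurable.aestronglyMeasurable (by fun_prop)
  · rw [norm_inv]
    exact inv_anti₀ hd (hdle _ _ (hf _).1 (hf _).2)

theorem integrable_contour_integral (hp : 0 < p) (hc : 0 < c) (hm : p * m < 1)
    (hfm : Measurable f) (hf : ∀ η, 0 ≤ f η ∧ f η ≤ m) (hK : Integrable fun η => f η * K η)
    {n : ℕ} (hn : 2 ≤ n) :
    Integrable fun y => (hyperbola p c y ^ n)⁻¹ *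
      (∫ η, f η * K η / (1 - hyperbola p c y * f η)) * hyperbolaDeriv p c y := by
  have := (integrable_prod_resolvent_mul hp hc hm hfm hf hK hn).integral_prod_left
  simpa only [integral_mul_const, integral_const_mul] using this

theorem contour_integral_eq (hp : 0 < p) (hc : 0 < c) (hm : p * m < 1)
    (hfm : Measurable f) (hf : ∀ η, 0 ≤ f η ∧ f η ≤ m) (hK : Integrable fun η => f η * K η)
    {n : ℕ} (hn : 2 ≤ n) :
    ∫ y, (hyperbola p c y ^ n)⁻¹ *
      (∫ η, f η * K η / (1 - hyperbola p c y * f η)) * hyperbolaDeriv p c y =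
      2 * Real.pi * Complex.I * ∫ η, (f η : ℂ) ^ n * K η := by
  have h := integral_integral_swap (f := fun y η => (hyperbola p c y ^ n)⁻¹ *
    (f η * K η / (1 - hyperbola p c y * f η)) * hyperbolaDeriv p c y)
    (integrable_prod_resolvent_mul hp hc hm hfm hf hK hn)
  simp only [integral_mul_const, integral_const_mul] at h
  rw [h, ← integral_const_mul]
  refine integral_congr_ae (ae_of_all _ fun η => ?_)
  have hfp : p * f η < 1 := (mul_le_mul_of_nonneg_left (hf η).2 hp.le).trans_lt hm
  simp only
  rw [← mul_assoc, ← integral_resolvent_hyperbola hp hc (hf η).1 hfp hn, ← integral_mul_const]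
  refine integral_congr_ae (ae_of_all _ fun y => ?_)
  simp only [div_eq_mul_inv]; ring

/-- Addition formula: `sinh (i θ + y) = i sin θ cosh y + cos θ sinh y`. -/
theorem sinhContour_zero (b θ y : ℝ) :
    sinhContour 0 b θ y = hyperbola (-(b * Real.sin θ)) (b * Real.cos θ) y := by
  rw [sinhContour, hyperbola, Complex.sinh_add, mul_comm Complex.I (θ : ℂ), Complex.sinh_mul_I,
    Complex.cosh_mul_I]
  push_cast
  linear_combination (b * Complex.sin θ * Complex.cosh y) * Complex.I_sq

theorem deriv_sinhContour_zero (b θ y : ℝ) :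
    deriv (sinhContour 0 b θ) y = hyperbolaDeriv (-(b * Real.sin θ)) (b * Real.cos θ) y := by
  rw [funext (sinhContour_zero b θ)]
  exact (hasDerivAt_hyperbola _ _ y).deriv

end Contour

/-! ### Bounds for the symbol on the line -/

namespace CondPhiSym

variable {ν : Measure ℝ} {Φ : ℂ → ℂ} {β : ℝ}

theorem apply_linePt_eq_re (hΦ : CondPhiSym ν Φ β) (η : ℝ) :
    Φ (linePt β η) = ((Φ (linePt β η)).re : ℂ) :=
  Complex.ext (by simp) (by simp [hΦ.im_eq_zero])

variable [IsFiniteMeasure ν]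

theorem measurable_re (hΦ : CondPhiSym ν Φ β) : Measurable fun η => (Φ (linePt β η)).re := by
  simp_rw [hΦ.apply_linePt, ← charFun_withDensity_exp]
  exact Complex.measurable_re.comp measurable_charFun

/-- The triangle inequality `|E exp ((β + i η) Y)| ≤ E exp (β Y)`; this makes `1 / f 0` the nearest
pole. -/
theorem re_le (hΦ : CondPhiSym ν Φ β) (η : ℝ) :
    (Φ (linePt β η)).re ≤ (Φ (linePt β 0)).re := by
  rw [hΦ.apply_linePt, hΦ.apply_linePt, Complex.ofReal_zero, zero_mul, add_zero,
    complexMGF_ofReal, Complex.ofReal_re]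
  refine (Complex.re_le_norm _).trans (norm_complexMGF_le_mgf.trans_eq ?_)
  simp

end CondPhiSym

end

/-! ### The pricing formula -/

theorem mainTheorem9 {Ω : Type*} [MeasurableSpace Ω] (Q : Measure Ω) [IsProbabilityMeasure Q]
    (Y : ℕ → Ω → ℝ) (hY : IsIID Q Y)
    (Φ : ℂ → ℂ) (β : ℝ) (hΦ : CondPhiSym (Q.map (Y 0)) Φ β)
    (G : ℝ → ℝ) (hG : CondG G β)
    (q₀ : ℝ) (hq₀ : 0 < q₀) (hq₀' : q₀ ≤ 1) (n : ℕ) (hn : 2 < n)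
    (r₀ : ℝ) (hr₀ : 0 < r₀) (hr₀' : r₀ < 1 / (Φ (linePt β 0)).re)
    (θ : ℝ) (hθ : -(Real.pi / 2) < θ) (hθ' : θ < 0) :
    ∃ σ b : ℝ, 0 < b ∧ σ - b * Real.sin θ = r₀ ∧
      -- the integrands have no singularity on the contours
      (∀ y : ℝ, sinhContour σ b θ y ≠ 0) ∧
      (∀ y η : ℝ, 1 - sinhContour σ b θ y * Φ (linePt β η) ≠ 0) ∧
      -- the price is well defined at almost every starting point, and locally integrable
      (∀ᵐ x : ℝ, Integrable (fun w => G (randomWalk Y x n w)) Q) ∧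
      LocallyIntegrable (fun x : ℝ => europeanPrice Q Y G q₀ n x) volume ∧
      -- the formula in the sense of generalized functions of `x`
      (∀ φ : ℝ → ℂ, ContDiff ℝ ∞ φ → HasCompactSupport φ →
        (∀ y : ℝ, Integrable (innerPairingIntegrand Φ hG φ (sinhContour σ b θ y)) volume) ∧
        Integrable (pathIntegrand (sinhContour σ b θ)
          (fun q => (q ^ n)⁻¹ * innerPairing Φ hG φ q)) volume ∧
        ∫ x : ℝ, (europeanPrice Q Y G q₀ n x : ℂ) * φ x =
          (q₀ : ℂ) ^ n / (2 * (Real.pi : ℂ) * Complex.I) *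
            pathIntegral (sinhContour σ b θ)
              (fun q => (q ^ n)⁻¹ * innerPairing Φ hG φ q)) ∧
      -- the formula in the classical sense, if `Φ Ĝ` is integrable over the line
      (Integrable (fun η : ℝ => Φ (linePt β η) * payoffFourier hG η) volume →
        (∀ x y : ℝ, Integrable (innerIntegrand Φ hG x (sinhContour σ b θ y)) volume) ∧
        (∀ x : ℝ, Integrable (pathIntegrand (sinhContour σ b θ)
          (fun q => (q ^ n)⁻¹ * innerIntegral Φ hG x q)) volume) ∧
        (∀ᵐ x : ℝ, (europeanPrice Q Y G q₀ n x : ℂ) =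
          (q₀ : ℂ) ^ n / (2 * (Real.pi : ℂ) * Complex.I) *
            pathIntegral (sinhContour σ b θ)
              (fun q => (q ^ n)⁻¹ * innerIntegral Φ hG x q)) ∧
        (∀ x : ℝ, ContinuousAt (fun x' : ℝ => europeanPrice Q Y G q₀ n x') x →
          (europeanPrice Q Y G q₀ n x : ℂ) =
          (q₀ : ℂ) ^ n / (2 * (Real.pi : ℂ) * Complex.I) *
            pathIntegral (sinhContour σ b θ)
              (fun q => (q ^ n)⁻¹ * innerIntegral Φ hG x q))) := by
  have hν : IsProbabilityMeasure (Q.map (Y 0)) :=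
    Measure.isProbabilityMeasure_map (hY.measurable 0).aemeasurable
  set f : ℝ → ℝ := fun η => (Φ (linePt β η)).re with hf_def
  have hΦf : ∀ η, Φ (linePt β η) = (f η : ℂ) := hΦ.apply_linePt_eq_re
  have hfm : Measurable f := hΦ.measurable_re
  have hf : ∀ η, 0 ≤ f η ∧ f η ≤ f 0 := fun η => ⟨hΦ.re_nonneg η, hΦ.re_le η⟩
  -- Since `1 / 0 = 0`, the condition `0 < r₀ < 1 / f 0` already forces `f 0` to be positive.
  have hf0 : 0 < f 0 := one_div_pos.1 (hr₀.trans hr₀')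
  -- the walk and its tilted law
  set S : Ω → ℝ := fun w => ∑ j ∈ Finset.range n, Y j w with hS_def
  have hS : Measurable S := Finset.measurable_fun_sum _ fun j _ => hY.measurable j
  set μ : Measure ℝ := tiltedLaw Q S β with hμ_def
  have hμ : IsFiniteMeasure μ :=
    isFiniteMeasure_tiltedLaw hS (hY.integrable_exp_sum hΦ.integrable_exp n)
  have hchar : ∀ η, charFun μ η = (f η : ℂ) ^ n := by
    intro η
    rw [hμ_def, charFun_tiltedLaw hS, hY.complexMGF_sum, ← hΦf, hΦ.apply_linePt,
      complexMGF_id_map (hY.measurable 0).aemeasurable]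
  have hprice : ∀ x, (europeanPrice Q Y G q₀ n x : ℂ) = (q₀ : ℂ) ^ n *
      ((Real.exp (β * x) : ℂ) * ∫ s, dampedPayoff G β (x + s) ∂μ) := by
    intro x
    rw [← integral_tiltedLaw hS hG.measurable, europeanPrice, integral_const_mul]
    push_cast; rfl
  have hGm := measurable_dampedPayoff (β := β) hG.measurable
  -- the contour
  have hsin : Real.sin θ < 0 :=
    Real.sin_neg_of_neg_of_neg_pi_lt hθ' (by linarith [Real.pi_pos])
  have hcos : 0 < Real.cos θ := Real.cos_pos_of_mem_Ioo ⟨hθ, by linarith [Real.pi_pos]⟩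
  -- Forced by the choice `σ = 0` and the requirement `σ - b sin θ = r₀`; positive because `sin θ <
  -- 0`.
  set b : ℝ := r₀ / -Real.sin θ with hb_def
  have hb : 0 < b := div_pos hr₀ (neg_pos.2 hsin)
  have hbsin : -(b * Real.sin θ) = r₀ := by
    rw [hb_def]; field_simp [hsin.ne]
  set c : ℝ := b * Real.cos θ with hc_def
  have hc : 0 < c := mul_pos hb hcos
  have hm : r₀ * f 0 < 1 := (lt_div_iff₀ hf0).1 hr₀'
  have hγ : ∀ y, sinhContour 0 b θ y = hyperbola r₀ c y := fun y => by
    rw [sinhContour_zero, hbsin]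
  have hγ' : ∀ y, deriv (sinhContour 0 b θ) y = hyperbolaDeriv r₀ c y := fun y => by
    rw [deriv_sinhContour_zero, hbsin]
  have hfr : ∀ η, r₀ * f η < 1 := fun η => (mul_le_mul_of_nonneg_left (hf η).2 hr₀.le).trans_lt hm
  have hpre : ∀ A : ℂ, (q₀ : ℂ) ^ n / (2 * (Real.pi : ℂ) * Complex.I) *
      (1 / (2 * (Real.pi : ℂ)) * (2 * Real.pi * Complex.I * A)) =
      (q₀ : ℂ) ^ n * (1 / (2 * (Real.pi : ℂ)) * A) := by
    intro A
    have : (Real.pi : ℂ) ≠ 0 := by exact_mod_cast Real.pi_ne_zero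
    field_simp
  -- the contour integral of the resolvent against a kernel
  have hquot : ∀ (k : ℝ → ℂ) (q : ℂ) (η : ℝ), k η * symbolQuotient Φ hG q η =
      f η * (k η * payoffFourier hG η) / (1 - q * f η) := by
    intro k q η
    rw [symbolQuotient, hΦf]; ring
  -- The kernel `k` is the transform of a test function in the distributional statement and `exp (i
  -- x ξ)` in the classical one.
  have hcont : ∀ k : ℝ → ℂ, Integrable (fun η => f η * (k η * payoffFourier hG η)) →
      (∀ y, Integrable fun η => k η * symbolQuotient Φ hG (sinhContour 0 b θ y) η) ∧
      Integrable (pathIntegrand (sinhContour 0 b θ) fun q => (q ^ n)⁻¹ *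
        (1 / (2 * (Real.pi : ℂ)) * ∫ η, k η * symbolQuotient Φ hG q η)) ∧
      (q₀ : ℂ) ^ n / (2 * (Real.pi : ℂ) * Complex.I) *
        pathIntegral (sinhContour 0 b θ) (fun q => (q ^ n)⁻¹ *
          (1 / (2 * (Real.pi : ℂ)) * ∫ η, k η * symbolQuotient Φ hG q η)) =
        (q₀ : ℂ) ^ n * (1 / (2 * (Real.pi : ℂ)) *
          ∫ η, (f η : ℂ) ^ n * (k η * payoffFourier hG η)) := by
    intro k hk
    have he : ∀ y, pathIntegrand (sinhContour 0 b θ) (fun q => (q ^ n)⁻¹ *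
        (1 / (2 * (Real.pi : ℂ)) * ∫ η, k η * symbolQuotient Φ hG q η)) y =
        1 / (2 * (Real.pi : ℂ)) * ((hyperbola r₀ c y ^ n)⁻¹ *
          (∫ η, f η * (k η * payoffFourier hG η) / (1 - hyperbola r₀ c y * f η)) *
          hyperbolaDeriv r₀ c y) := by
      intro y
      simp only [pathIntegrand, hγ, hγ', hquot]
      ring
    refine ⟨fun y => ?_, ?_, ?_⟩
    · simp_rw [hquot, hγ]
      exact integrable_resolvent_mul hr₀ hc hm hfm hf hk y
    · rw [funext he]
      exact (integrable_contour_integral hr₀ hc hm hfm hf hk (by omega)).const_mul _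
    · rw [pathIntegral, funext he, integral_const_mul,
        contour_integral_eq hr₀ hc hm hfm hf hk (by omega), hpre]
  refine ⟨0, b, hb, by linarith, fun y => ?_, fun y η => ?_, ?_, ?_, fun φ hφ hφc => ?_,
    fun hi => ?_⟩
  · rw [hγ]; exact hyperbola_ne_zero hr₀ y
  · rw [hγ, hΦf]
    exact Complex.slitPlane_ne_zero (one_sub_hyperbola_mul_mem_slitPlane hc (hfr η) y)
  · filter_upwards [ae_integrable_translate (μ := μ) hGm hG.memLp] with x hx
    exact (integrable_tiltedLaw_iff hS hG.measurable β x).1 hx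
  · have h1 := (locallyIntegrable_exp_mul_translate hG μ).smul ((q₀ : ℂ) ^ n)
    intro x
    obtain ⟨U, hU, hUi⟩ := h1 x
    refine ⟨U, hU, ?_⟩
    have h2 : IntegrableOn (fun x => (europeanPrice Q Y G q₀ n x : ℂ)) U := by
      refine hUi.congr (ae_of_all _ fun x => ?_)
      simp only [hprice, Pi.smul_apply, smul_eq_mul]
    simpa [IntegrableOn] using h2.re
  · have hT := integrable_testTransform_mul_payoffFourier hG hφ hφc
    have hk : Integrable fun η => f η * (testTransform φ (linePt β η) * payoffFourier hG η) := by
      refine hT.bdd_mul (c := f 0) (by fun_prop) (ae_of_all _ fun η => ?_)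
      rw [Complex.norm_real, Real.norm_of_nonneg (hf η).1]
      exact (hf η).2
    obtain ⟨h1, h2, h3⟩ := hcont (fun η => testTransform φ (linePt β η)) hk
    refine ⟨h1, h2, Eq.trans ?_ h3.symm⟩
    simp_rw [hprice, mul_assoc ((q₀ : ℂ) ^ n)]
    rw [integral_const_mul, integral_exp_mul_translate_mul hG hφ hφc]
    simp_rw [hchar]
  · have hi' : Integrable fun η => (f η : ℂ) * payoffFourier hG η := by
      simpa only [hΦf] using hi
    -- One factor `f` stays with `Ĝ`, because only the product is assumed integrable; the other `n -
    -- 1` factors are bounded.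
    have hn' : ∀ η, charFun μ η * payoffFourier hG η =
        (f η : ℂ) ^ (n - 1) * (f η * payoffFourier hG η) := by
      intro η
      rw [hchar, ← mul_assoc, ← pow_succ, Nat.sub_add_cancel (by omega)]
    have hin : Integrable fun η => charFun μ η * payoffFourier hG η := by
      simp_rw [hn']
      refine hi'.bdd_mul (c := f 0 ^ (n - 1)) (by fun_prop) (ae_of_all _ fun η => ?_)
      rw [norm_pow, Complex.norm_real, Real.norm_of_nonneg (hf η).1]
      exact pow_le_pow_left₀ (hf η).1 (hf η).2 _
    have hk : ∀ x : ℝ, Integrable fun η =>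
        f η * (Complex.exp (Complex.I * x * linePt β η) * payoffFourier hG η) := by
      intro x
      have hl := continuous_linePt β
      have := hi'.bdd_mul (f := fun η => Complex.exp (Complex.I * x * linePt β η))
        (c := Real.exp (β * x)) (by fun_prop) (ae_of_all _ fun η => (norm_exp_I_mul_linePt _ _ _).le)
      refine this.congr (ae_of_all _ fun η => ?_)
      simp only; ring
    have h := fun x : ℝ => hcont (fun η => Complex.exp (Complex.I * x * linePt β η)) (hk x)
    set W : ℝ → ℂ := fun x => (q₀ : ℂ) ^ n * (1 / (2 * (Real.pi : ℂ)) *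
      ∫ η, Complex.exp (Complex.I * x * linePt β η) * (charFun μ η * payoffFourier hG η)) with hW
    have hWc : Continuous W :=
      continuous_const.mul (continuous_const.mul (continuous_integral_exp_mul hin β))
    have hWe : ∀ x : ℝ, (q₀ : ℂ) ^ n / (2 * (Real.pi : ℂ) * Complex.I) *
        pathIntegral (sinhContour 0 b θ) (fun q => (q ^ n)⁻¹ * innerIntegral Φ hG x q) = W x := by
      intro x
      refine (h x).2.2.trans ?_
      simp only [hW]
      congr 2
      refine integral_congr_ae (ae_of_all _ fun η => ?_)
      simp only [hchar]; ring
    have hae : ∀ᵐ x : ℝ, (europeanPrice Q Y G q₀ n x : ℂ) = W x := by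
      filter_upwards [ae_exp_mul_translate_eq hG μ hin] with x hx
      rw [hprice, hx]
    refine ⟨fun x => (h x).1, fun x => (h x).2.1, ?_, fun x hx => ?_⟩
    · simpa only [hWe] using hae
    · rw [hWe]
      -- A set of full Lebesgue measure is dense, so at a point of continuity the price and the
      -- continuous `W` have the same limit along it.
      have hd : Dense {x : ℝ | (europeanPrice Q Y G q₀ n x : ℂ) = W x} := Measure.dense_of_ae hae
      have hV : ContinuousAt (fun x' => (europeanPrice Q Y G q₀ n x' : ℂ)) x :=
        Complex.continuous_ofReal.continuousAt.comp hx
      have hne := mem_closure_iff_nhdsWithin_neBot.1 (hd x)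
      refine tendsto_nhds_unique_of_eventuallyEq (l := nhdsWithin x
        {x | (europeanPrice Q Y G q₀ n x : ℂ) = W x})
        (hV.tendsto.mono_left nhdsWithin_le_nhds)
        (hWc.continuousAt.tendsto.mono_left nhdsWithin_le_nhds) ?_
      exact eventually_mem_nhdsWithin
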